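/- Graphs are finite, undirected and loopless, possibly with multiple edges. For graphs $H$, $G$ and an integer $r\ge 0$, write $H\le^{r} G$ ("$H$ is an $r$-diameter contraction of $G$") if there is a surjection $\sigma:V(G)\to V(H)$ such that for every $x\in V(H)$ the graph $G[\sigma^{-1}(x)]$ is connected and of diameter at most $r$, and for all distinct $x,y\in V(H)$ we have $\{x,y\}\in E(H)$ if and only if $G[\sigma^{-1}(x)\cup\sigma^{-1}(y)]$ is connected. $H$ is a contraction of $G$, written $H\le G$, if $H\le^{r}G$ for some $r$; write $H\le^{(s)}G$ if moreover $\sigma$ can be chosen with $|\sigma^{-1}(x)|\le s$ for all $x\in V(H)$. For $k\ge 1$ let $\Gamma_k$ be the uniformly triangulated $(k\times k)$-grid: the grid on $\{0,\dots,k-1\}^2$ together with all edges $\{(i+1,j),(i,j+1)\}$ with $0\le i,j\le k-2$ and all edges joining $(k-1,k-1)$ to the other vertices on the boundary of the grid. Let $\mathsf{tw}(G)$ denote treewidth, and let $\mathbf{bcg}(G)$ be the maximum $k$ with $\Gamma_k\le G$ ($0$ if there is none, i.e. if $G$ is not connected). A class $\mathcal G$ of graphs has the SQGC (subquadratic grid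 contraction) property with exponent $c$, where $1\le c<2$, if there is a constant $C$ such that for every integer $t\ge 1$ every $G\in\mathcal G$ with $\Gamma_t\not\le G$ satisfies $\mathsf{tw}(G)\le C\,t^{c}$. For positive integers $c_1,c_2$, the $(c_1,c_2)$-extension $\mathcal G^{(c_1,c_2)}$ is the class of all graphs $H$ for which there are $G\in\mathcal G$ and a graph $J$ with $G\le^{(c_1)}J$ and $H\le^{c_2}J$. **Theorem.** Let $\mathcal G$ be a class of graphs, $c$ a real number with $1\le c<2$, and $c_1,c_2$ positive integers. (1) If $\mathcal G$ has the SQGC property with exponent $c$, then so does $\mathcal G^{(c_1,c_2)}$. (2) If $\lambda\ge 0$ is a real number with $\mathsf{tw}(G)\le\lambda\cdot\mathbf{bcg}(G)^{c}$ for every $G\in\mathcal G$, then every $H\in\mathcal G^{(c_1,c_2)}$ satisfies $$\mathsf{tw}(H)\le (c_1+1)\bigl(\lambda\cdot[(2c_2+1)(\mathbf{bcg}(H)+2)+1]^{c}+1\bigr)-1 .$$ -/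

import Mathlib

universe u

/-- A finite undirected loopless graph in which multiple edges are allowed: `mult x y` is the
number of edges with ends `x` and `y`. -/
structure MultiGraph : Type (u + 1) where
  /-- the vertex set -/
  V : Type u
  finite : Finite V
  /-- the multiplicity of the edge `{x, y}` -/
  mult : V → V → ℕ
  symm : ∀ x y, mult x y = mult y x
  loopless : ∀ x, mult x x = 0

/-- The simple graph underlying a multigraph. Connectivity, distances, contractions and
tree-decompositions only depend on which pairs of vertices are joined by an edge. -/
def MultiGraph.simple (G : MultiGraph.{u}) : SimpleGraph G.V where
  Adj x y := 0 < G.mult x y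
  symm := ⟨fun x y h => by rw [G.symm y x]; exact h⟩
  loopless := ⟨fun x h => by rw [G.loopless x] at h; exact absurd h (lt_irrefl 0)⟩

section Contractions

variable {V W : Type*}

/-- `H ≤_σ^c G`: the map `σ : V(G) → V(H)` is surjective, every `G[σ⁻¹(x)]` is connected of
diameter at most `c` (distances being numbers of edges, measured in `G[σ⁻¹(x)]`), and distinct
`x`, `y` are adjacent in `H` iff `G[σ⁻¹(x) ∪ σ⁻¹(y)]` is connected. -/
structure IsContractionMap (c : ℕ) (σ : V → W) (H : SimpleGraph W) (G : SimpleGraph V) : Prop where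
  surjective : Function.Surjective σ
  connected : ∀ x, (G.induce (σ ⁻¹' {x})).Connected
  ediam_le : ∀ x, (G.induce (σ ⁻¹' {x})).ediam ≤ (c : ℕ∞)
  adj_iff : ∀ x y, x ≠ y →
    (H.Adj x y ↔ (G.induce (σ ⁻¹' {x} ∪ σ ⁻¹' {y})).Connected)

/-- `H` is a `c`-diameter contraction of `G`. -/
def IsDiamContraction (c : ℕ) (H : SimpleGraph W) (G : SimpleGraph V) : Prop :=
  ∃ σ : V → W, IsContractionMap c σ H G

/-- `H` is an `s`-size contraction of `G`: a contraction all of whose fibres have at most `s`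
vertices. -/
def IsSizeContraction (s : ℕ) (H : SimpleGraph W) (G : SimpleGraph V) : Prop :=
  ∃ (c : ℕ) (σ : V → W), IsContractionMap c σ H G ∧
    ∀ x, (σ ⁻¹' {x}).Finite ∧ (σ ⁻¹' {x}).ncard ≤ s

/-- `H` is a contraction of `G`. -/
def IsContraction (H : SimpleGraph W) (G : SimpleGraph V) : Prop :=
  ∃ c : ℕ, IsDiamContraction c H G

end Contractions

/-- The uniformly triangulated grid `Γ_k` on `{0, …, k-1}²`: the `(k × k)`-grid, the diagonals
`{(i+1, j), (i, j+1)}`, and all edges between the corner `(k-1, k-1)` and the other vertices on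
the boundary of the grid. (`Γ_1` is one vertex and `Γ_2` is the complete graph on 4 vertices.) -/
def triGrid (k : ℕ) : SimpleGraph (Fin k × Fin k) :=
  SimpleGraph.fromRel fun p q =>
    (Nat.dist p.1 q.1 + Nat.dist p.2 q.2 = 1) ∨
    ((p.1 : ℕ) = q.1 + 1 ∧ (q.2 : ℕ) = p.2 + 1) ∨
    (((p.1 : ℕ) + 1 = k ∧ (p.2 : ℕ) + 1 = k) ∧
      ((q.1 : ℕ) = 0 ∨ (q.1 : ℕ) + 1 = k ∨ (q.2 : ℕ) = 0 ∨ (q.2 : ℕ) + 1 = k))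

/-- A tree-decomposition of `G` whose tree has vertex set `{0, …, n-1}`. -/
structure TreeDecomposition {V : Type*} (G : SimpleGraph V) (n : ℕ) where
  tree : SimpleGraph (Fin n)
  isTree : tree.IsTree
  bag : Fin n → Set V
  cover : ⋃ t, bag t = Set.univ
  edge_mem : ∀ x y, G.Adj x y → ∃ t, x ∈ bag t ∧ y ∈ bag t
  connected : ∀ v, (tree.induce {t | v ∈ bag t}).Connected

/-- The width: maximum size of a bag, minus one. -/
noncomputable def TreeDecomposition.width {V : Type*} {G : SimpleGraph V} {n : ℕ}
    (D : TreeDecomposition G n) : ℕ :=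
  (Finset.univ.sup fun t => (D.bag t).ncard) - 1

namespace MultiGraph

/-- The treewidth: the minimum width of a tree-decomposition. (The graph without vertices gets
the value `0`.) -/
noncomputable def treewidth (G : MultiGraph.{u}) : ℕ :=
  sInf {w | ∃ (n : ℕ) (D : TreeDecomposition G.simple n), D.width = w}

/-- `bcg(G)`: the maximum `k` such that `Γ_k` is a contraction of `G`, and `0` if there is none,
that is, if `G` is disconnected. -/
noncomputable def bcg (G : MultiGraph.{u}) : ℕ :=
  sSup {k | IsContraction (triGrid k) G.simple}

end MultiGraph

/-- The subquadratic grid contraction property with exponent `c`: the graphs in `𝒢` that exclude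
`Γ_t` as a contraction have treewidth `O(t^c)`. -/
def HasSQGC (𝒢 : Set MultiGraph.{u}) (c : ℝ) : Prop :=
  ∃ C : ℝ, ∀ G ∈ 𝒢, ∀ t : ℕ, 1 ≤ t → ¬ IsContraction (triGrid t) G.simple →
    (G.treewidth : ℝ) ≤ C * (t : ℝ) ^ c

/-- The `(c₁, c₂)`-extension of `𝒢`: all `H` such that some `G ∈ 𝒢` is a `c₁`-size contraction and
`H` is a `c₂`-diameter contraction of one and the same graph `J`. -/
def graphExtension (𝒢 : Set MultiGraph.{u}) (c₁ c₂ : ℕ) : Set MultiGraph.{u} :=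
  {H | ∃ G ∈ 𝒢, ∃ J : MultiGraph.{u},
    IsSizeContraction c₁ G.simple J.simple ∧ IsDiamContraction c₂ H.simple J.simple}

/-!
Let `G` be a `c₁`-size contraction and `H` a `c₂`-diameter contraction of the same graph `J`.
Bags of tree-decompositions can be pulled back from `G` to `J` and pushed forward from `J` to `H`,
so `tw(H) + 1 ≤ c₁ (tw(G) + 1)`, and everything rests on a comparison of grid contractions
(`isContraction_triGrid_of_isContractionMap`): if `Γ_m` is a contraction of `J` and
`m > (2 c₂ + 1) (K + 1)`, then `Γ_K` is a contraction of `H`.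

Write `c = c₂` and `s = 2 c + 1`. Each vertex `x` of `H` has a shadow in `Γ_m`, the image of its
fibre in `J`. Inside the triangulated plane the shadow is connected of diameter at most `c`, and
adjacent vertices have adjacent or intersecting shadows. The shadows that meet a given connected
set of `Γ_m` belong to a connected set of vertices of `H`. Place the vertices of `Γ_K`
at the branch points of the sublattice of mesh `s`; branch points on or beyond the outermost lines,
together with everything out there (the frame), stand for the corner of `Γ_K` that is adjacent to
the whole boundary. The vertex `x` may be labelled `i` if its shadow lies in the open star of the
branch point `i` in the coarse triangulation (for the corner: outside the convex core spanned by
the other branch points). Adjacent vertices then receive equal or adjacent labels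
(`triGrid_adj_of_region`), and the vertices with shadow on a coarse edge can only be labelled by its
two ends (`eq_cell_of_region_ray`), which forces all the edges of `Γ_K` to be present. It remains to
choose labels with connected label classes.

Orient the coarse lines so that at each branch point every second ray is outgoing, and let the seed
of `i` consist of the branch point with the first halves (`c` steps) of its three outgoing edges,
and the frame for the corner. No shadow meets two seeds (`eq_of_mem_seed`). The point of the
orientation is that a shadow meeting two coarse edges at a common branch point meets an outgoing
one, so a shadow that avoids all seeds but meets a coarse edge lies in the open stars of both of
its ends (`hexNear_branch_of_fiber`). Hence labels spread from the seeds
(`exists_connected_labelling`): along a coarse edge both labels are allowed for every unlabelled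
vertex, and when all coarse edges are exhausted, the remaining shadows lie inside single coarse
triangles and admit every label of a neighbour (`region_of_hexNear_one`).
-/

/-! ### Connectedness through cuts -/

/-- An induced subgraph is connected iff it is nonempty and every cut of its vertex set is crossed
by an edge. All connectivity arguments below use this form. -/
theorem connected_induce_iff_forall_cut {V : Type*} {G : SimpleGraph V} {S : Set V} :
    (G.induce S).Connected ↔ S.Nonempty ∧ ∀ A : Set V, (∃ a ∈ S, a ∈ A) → (∃ b ∈ S, b ∉ A) →
      ∃ u ∈ S, ∃ v ∈ S, u ∈ A ∧ v ∉ A ∧ G.Adj u v := by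
  constructor
  · intro h
    refine ⟨Set.nonempty_coe_sort.1 h.nonempty, ?_⟩
    rintro A ⟨a, ha, haA⟩ ⟨b, hb, hbA⟩
    obtain ⟨w⟩ := h.preconnected ⟨a, ha⟩ ⟨b, hb⟩
    obtain ⟨d, -, h1, h2⟩ := w.exists_boundary_dart {x | (x : V) ∈ A} haA hbA
    exact ⟨d.fst, d.fst.2, d.snd, d.snd.2, h1, h2, d.adj⟩
  · rintro ⟨⟨a, ha⟩, h⟩
    rw [SimpleGraph.connected_iff_exists_forall_reachable]
    refine ⟨⟨a, ha⟩, ?_⟩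
    by_contra! hcon
    obtain ⟨⟨b, hb⟩, hab⟩ := hcon
    obtain ⟨u, hu, v, hv, ⟨hu', hur⟩, hvA, huv⟩ := h
      {x | ∃ hx : x ∈ S, (G.induce S).Reachable ⟨a, ha⟩ ⟨x, hx⟩}
      ⟨a, ha, ha, SimpleGraph.Reachable.refl _⟩ ⟨b, hb, fun ⟨_, h'⟩ => hab h'⟩
    exact hvA ⟨hv, hur.trans (SimpleGraph.Adj.reachable (by simpa using huv))⟩

theorem connected_induce_cut {V : Type*} {G : SimpleGraph V} {S : Set V}
    (h : (G.induce S).Connected) (A : Set V) {a b : V} (ha : a ∈ S) (haA : a ∈ A) (hb : b ∈ S)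
    (hbA : b ∉ A) : ∃ u ∈ S, ∃ v ∈ S, u ∈ A ∧ v ∉ A ∧ G.Adj u v :=
  (connected_induce_iff_forall_cut.1 h).2 A ⟨a, ha, haA⟩ ⟨b, hb, hbA⟩

theorem connected_induce_union_of_adj {V : Type*} {G : SimpleGraph V} {S T : Set V} {u v : V}
    (hS : (G.induce S).Connected) (hT : (G.induce T).Connected) (hu : u ∈ S) (hv : v ∈ T)
    (huv : G.Adj u v) : (G.induce (S ∪ T)).Connected := by
  rw [connected_induce_iff_forall_cut]
  refine ⟨⟨u, Or.inl hu⟩, ?_⟩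
  rintro A ⟨a, ha, haA⟩ ⟨b, hb, hbA⟩
  by_cases hS' : (∃ a ∈ S, a ∈ A) ∧ ∃ b ∈ S, b ∉ A
  · obtain ⟨x, hx, y, hy, h⟩ := (connected_induce_iff_forall_cut.1 hS).2 A hS'.1 hS'.2
    exact ⟨x, Or.inl hx, y, Or.inl hy, h⟩
  by_cases hT' : (∃ a ∈ T, a ∈ A) ∧ ∃ b ∈ T, b ∉ A
  · obtain ⟨x, hx, y, hy, h⟩ := (connected_induce_iff_forall_cut.1 hT).2 A hT'.1 hT'.2
    exact ⟨x, Or.inr hx, y, Or.inr hy, h⟩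
  push Not at hS' hT'
  by_cases huA : u ∈ A <;> by_cases hvA : v ∈ A
  · rcases hb with hb | hb
    · exact absurd (hS' ⟨u, hu, huA⟩ b hb) hbA
    · exact absurd (hT' ⟨v, hv, hvA⟩ b hb) hbA
  · exact ⟨u, Or.inl hu, v, Or.inr hv, huA, hvA, huv⟩
  · exact ⟨v, Or.inr hv, u, Or.inl hu, hvA, huA, huv.symm⟩
  · rcases ha with ha | ha
    · exact absurd (hS' ⟨a, ha, haA⟩ u hu) huA
    · exact absurd (hT' ⟨a, ha, haA⟩ v hv) hvA

theorem connected_induce_insert {V : Type*} {G : SimpleGraph V} {S : Set V} {u v : V}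
    (hS : (G.induce S).Connected) (hu : u ∈ S) (huv : G.Adj u v) :
    (G.induce (insert v S)).Connected := by
  have h : (G.induce {v}).Connected := by
    rw [connected_induce_iff_forall_cut]
    refine ⟨⟨v, rfl⟩, ?_⟩
    rintro A ⟨a, rfl, ha⟩ ⟨b, rfl, hb⟩
    exact absurd ha hb
  rw [Set.insert_eq, Set.union_comm]
  exact connected_induce_union_of_adj hS h hu rfl huv

/-! ### Contraction maps -/

section ContractionMaps

variable {V W : Type*} {c : ℕ} {σ : V → W} {H : SimpleGraph W} {G : SimpleGraph V}

/-- An edge between two fibres of a contraction map yields an edge of the contraction. -/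
theorem IsContractionMap.adj_of_adj (h : IsContractionMap c σ H G) {u v : V} (huv : G.Adj u v)
    (hne : σ u ≠ σ v) : H.Adj (σ u) (σ v) :=
  (h.adj_iff _ _ hne).2 (connected_induce_union_of_adj (h.connected _) (h.connected _) rfl rfl huv)

theorem IsContractionMap.exists_adj (h : IsContractionMap c σ H G) {x y : W} (hxy : H.Adj x y) :
    ∃ u v, σ u = x ∧ σ v = y ∧ G.Adj u v := by
  obtain ⟨a, ha⟩ := h.surjective x
  obtain ⟨b, hb⟩ := h.surjective y
  obtain ⟨u, hu, v, hv, hu', hv', huv⟩ := connected_induce_cut ((h.adj_iff x y hxy.ne).1 hxy)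
    (σ ⁻¹' {x}) (Or.inl ha) ha (Or.inr hb) (fun hb' => hxy.ne (by rw [← hb', hb]))
  exact ⟨u, v, hu', hv.resolve_left hv', huv⟩

theorem IsContractionMap.connected_preimage (h : IsContractionMap c σ H G) {Z : Set W}
    (hZ : (H.induce Z).Connected) : (G.induce (σ ⁻¹' Z)).Connected := by
  rw [connected_induce_iff_forall_cut]
  obtain ⟨z, hz⟩ := (connected_induce_iff_forall_cut.1 hZ).1
  obtain ⟨z', rfl⟩ := h.surjective z
  refine ⟨⟨z', hz⟩, ?_⟩
  rintro A ⟨a, ha, haA⟩ ⟨b, hb, hbA⟩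
  by_contra! hcon
  -- No edge crosses the cut, so each fibre lies on one of its sides and the cut descends to `Z`.
  have key : ∀ u v, σ u ∈ Z → σ u = σ v → u ∈ A → v ∈ A := by
    intro u v hu huv huA
    by_contra hvA
    obtain ⟨x, hx, y, hy, hxA, hyA, hxy⟩ :=
      connected_induce_cut (h.connected (σ u)) A rfl huA huv.symm hvA
    refine hcon x ?_ y ?_ hxA hyA hxy
    · rw [Set.mem_preimage, show σ x = σ u from hx]; exact hu
    · rw [Set.mem_preimage, show σ y = σ u from hy]; exact hu
  obtain ⟨p, hp, q, hq, ⟨u₀, hu₀, hu₀p⟩, hqA, hpq⟩ := connected_induce_cut hZ (σ '' A) ha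
    ⟨a, haA, rfl⟩ hb (by rintro ⟨x, hx, hxb⟩; exact hbA (key x b (by rw [hxb]; exact hb) hxb hx))
  obtain ⟨u, v, hu, rfl, huv⟩ := h.exists_adj hpq
  refine hcon u (by rw [Set.mem_preimage, hu]; exact hp) v hq
    (key u₀ u (by rw [hu₀p]; exact hp) (hu₀p.trans hu.symm) hu₀) (fun hv => hqA ⟨v, hv, rfl⟩) huv

theorem IsContractionMap.connected_image (h : IsContractionMap c σ H G) {Z : Set V}
    (hZ : (G.induce Z).Connected) : (H.induce (σ '' Z)).Connected := by
  rw [connected_induce_iff_forall_cut]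
  obtain ⟨z, hz⟩ := (connected_induce_iff_forall_cut.1 hZ).1
  refine ⟨⟨σ z, z, hz, rfl⟩, ?_⟩
  rintro A ⟨_, ⟨a, ha, rfl⟩, haA⟩ ⟨_, ⟨b, hb, rfl⟩, hbA⟩
  obtain ⟨u, hu, v, hv, huA, hvA, huv⟩ := connected_induce_cut hZ (σ ⁻¹' A) ha haA hb hbA
  exact ⟨σ u, ⟨u, hu, rfl⟩, σ v, ⟨v, hv, rfl⟩, huA, hvA,
    h.adj_of_adj huv (fun he => hvA (by rw [Set.mem_preimage, ← he]; exact huA))⟩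

/-- For finite graphs the bound on the diameters of the fibres is automatic. -/
theorem isContraction_of_connected_fibers [Finite V] [Finite W] (σ : V → W)
    (hs : Function.Surjective σ) (hc : ∀ x, (G.induce (σ ⁻¹' {x})).Connected)
    (hadj : ∀ x y, x ≠ y → (H.Adj x y ↔ ∃ u v, σ u = x ∧ σ v = y ∧ G.Adj u v)) :
    IsContraction H G := by
  have hfin : ∀ x, ∃ n : ℕ, (G.induce (σ ⁻¹' {x})).ediam ≤ n := by
    intro x
    have : Nonempty (σ ⁻¹' {x}) := (hc x).nonempty
    exact ⟨_, (ENat.natCast_toNat (SimpleGraph.connected_iff_ediam_ne_top.1 (hc x))).ge⟩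
  choose n hn using hfin
  obtain ⟨N, hN⟩ := (Set.finite_range n).bddAbove
  refine ⟨N, σ, hs, hc, fun x => (hn x).trans (by exact_mod_cast hN ⟨x, rfl⟩), ?_⟩
  intro x y hxy
  rw [hadj x y hxy]
  constructor
  · rintro ⟨u, v, hu, hv, huv⟩
    exact connected_induce_union_of_adj (hc x) (hc y) hu hv huv
  · intro h
    obtain ⟨a, ha⟩ := hs x
    obtain ⟨b, hb⟩ := hs y
    obtain ⟨u, hu, v, hv, hu', hv', huv⟩ := connected_induce_cut h (σ ⁻¹' {x})
      (Or.inl ha) ha (Or.inr hb) (fun hb' => hxy (by rw [← hb', hb]))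
    exact ⟨u, v, hu', hv.resolve_left hv', huv⟩

end ContractionMaps

/-! ### Growing a connected labelling -/

/-- Disjoint connected seeds extend to a partition into connected classes that respects a given
relation `allow` between vertices and labels, provided that every set `N` avoiding the seeds can be
entered from outside along an edge whose head in `N` allows all the labels allowed at its tail. -/
theorem exists_connected_labelling {W ι : Type*} [Finite W] [Nonempty ι] (H : SimpleGraph W)
    (allow : W → ι → Prop) (Z : ι → Set W) (hZc : ∀ i, (H.induce (Z i)).Connected)
    (hZa : ∀ i, ∀ x ∈ Z i, allow x i) (hZd : ∀ i j x, x ∈ Z i → x ∈ Z j → i = j)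
    (hgrow : ∀ N : Set W, N.Nonempty → (∀ i, ∀ x ∈ Z i, x ∉ N) →
      ∃ x ∈ N, ∃ y, y ∉ N ∧ H.Adj y x ∧ ∀ i, allow y i → allow x i) :
    ∃ τ : W → ι, (∀ i, ∀ x ∈ Z i, τ x = i) ∧ (∀ x, allow x (τ x)) ∧
      ∀ i, (H.induce (τ ⁻¹' {i})).Connected := by
  classical
  have key : ∀ (n : ℕ) (N : Set W) (τ : W → ι), N.ncard = n → (∀ i, ∀ x ∈ Z i, x ∉ N ∧ τ x = i) →
      (∀ x, x ∉ N → allow x (τ x)) → (∀ i, (H.induce (τ ⁻¹' {i} \ N)).Connected) →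
      ∃ τ : W → ι, (∀ i, ∀ x ∈ Z i, τ x = i) ∧ (∀ x, allow x (τ x)) ∧
        ∀ i, (H.induce (τ ⁻¹' {i})).Connected := by
    intro n
    induction n with
    | zero =>
      intro N τ hN h1 h2 h3
      obtain rfl : N = ∅ := (Set.ncard_eq_zero).1 hN
      exact ⟨τ, fun i x hx => (h1 i x hx).2, fun x => h2 x (Set.notMem_empty x),
        fun i => by rw [← Set.sdiff_empty (s := τ ⁻¹' {i})]; exact h3 i⟩
    | succ n ih =>
      intro N τ hN h1 h2 h3
      obtain ⟨x, hx, y, hy, hyx, hxy⟩ := hgrow N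
        (Set.nonempty_of_ncard_ne_zero (by omega)) (fun i x hx => (h1 i x hx).1)
      have hτ : ∀ z, z ≠ x → Function.update τ x (τ y) z = τ z :=
        fun z hz => Function.update_of_ne hz _ _
      refine ih (N \ {x}) (Function.update τ x (τ y))
        (by rw [Set.ncard_sdiff_singleton_of_mem hx, hN]; rfl) ?_ ?_ ?_
      · intro i z hz
        obtain ⟨hzN, hzi⟩ := h1 i z hz
        exact ⟨fun h => hzN h.1, by rw [hτ z (fun h => hzN (h ▸ hx)), hzi]⟩
      · intro z hz
        by_cases hzx : z = x
        · subst hzx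
          rw [Function.update_self]
          exact hxy _ (h2 y hy)
        · rw [hτ z hzx]
          exact h2 z (fun h => hz ⟨h, hzx⟩)
      · intro i
        by_cases hi : i = τ y
        · have : Function.update τ x (τ y) ⁻¹' {i} \ (N \ {x}) =
              insert x (τ ⁻¹' {i} \ N) := by
            ext z
            by_cases hzx : z = x
            · subst hzx; simp [hi]
            · simp [hzx]
          rw [this]
          exact connected_induce_insert (h3 i) ⟨hi.symm, hy⟩ hyx
        · have : Function.update τ x (τ y) ⁻¹' {i} \ (N \ {x}) = τ ⁻¹' {i} \ N := by
            ext z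
            by_cases hzx : z = x
            · subst hzx; simp [hx, Ne.symm hi]
            · simp [hzx]
          rw [this]
          exact h3 i
  have hex : ∃ τ : W → ι, ∀ i, ∀ x ∈ Z i, τ x = i := by
    refine ⟨fun x => if h : ∃ i, x ∈ Z i then h.choose else Classical.arbitrary ι, ?_⟩
    intro i x hx
    have h : ∃ i, x ∈ Z i := ⟨i, hx⟩
    simp only [dif_pos h]
    exact hZd _ _ x h.choose_spec hx
  obtain ⟨τ, hτ⟩ := hex
  refine key _ (⋃ i, Z i)ᶜ τ rfl ?_ ?_ ?_
  · intro i x hx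
    exact ⟨fun h => h (Set.mem_iUnion_of_mem i hx), hτ i x hx⟩
  · intro x hx
    obtain ⟨i, hi⟩ := Set.mem_iUnion.1 (Set.not_notMem.1 hx)
    rw [hτ i x hi]
    exact hZa i x hi
  · intro i
    have : τ ⁻¹' {i} \ (⋃ i, Z i)ᶜ = Z i := by
      ext x
      simp only [Set.mem_sdiff, Set.mem_preimage, Set.mem_singleton_iff, Set.mem_compl_iff,
        Set.mem_iUnion, not_not]
      constructor
      · rintro ⟨h, j, hj⟩
        rwa [← h, hτ j x hj]
      · exact fun h => ⟨hτ i x h, i, h⟩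
    rw [this]
    exact hZc i

/-! ### The triangular lattice -/

/-- `p` and `q` are at distance at most `n` in the triangular lattice on `ℤ × ℤ`, in which the
neighbours of the origin are `±(1, 0)`, `±(0, 1)` and `±(1, -1)`. -/
def HexNear (n : ℤ) (p q : ℤ × ℤ) : Prop :=
  (p.1 - q.1 ≤ n ∧ q.1 - p.1 ≤ n) ∧ (p.2 - q.2 ≤ n ∧ q.2 - p.2 ≤ n) ∧
    (p.1 + p.2 - (q.1 + q.2) ≤ n ∧ q.1 + q.2 - (p.1 + p.2) ≤ n)

/-- One of three lattice directions, pairwise at an angle of `120°`. Each line of the lattice is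
parallel to exactly one of them, which orients it. -/
def IsDir (d : ℤ × ℤ) : Prop := d = (1, 0) ∨ d = (-1, 1) ∨ d = (0, -1)

/-- The index `q` is that of one of the branch points standing for a vertex of the grid `Γ_K`
other than the corner `(K, K)` (vertices being numbered from `1`). -/
def InnerIndex (K : ℤ) (q : ℤ × ℤ) : Prop :=
  1 ≤ q.1 ∧ q.1 ≤ K ∧ 1 ≤ q.2 ∧ q.2 ≤ K ∧ q.1 + q.2 ≤ 2 * K - 1

open Classical in
/-- The vertex of `Γ_K`, numbered from `1`, that the index `q` stands for: all indices that are not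
inner stand for the corner `(K, K)`. -/
noncomputable def cell (K : ℤ) (q : ℤ × ℤ) : ℤ × ℤ := if InnerIndex K q then q else (K, K)

/-- The points at or beyond the outermost lattice lines of mesh `2 * c + 1`. -/
def Frame (c K : ℤ) (p : ℤ × ℤ) : Prop :=
  p.1 ≤ 0 ∨ p.2 ≤ 0 ∨ (2 * c + 1) * (K + 1) ≤ p.1 ∨ (2 * c + 1) * (K + 1) ≤ p.2 ∨
    (2 * c + 1) * (2 * K) ≤ p.1 + p.2

/-- The convex hull of the inner branch points. -/
def Core (c K : ℤ) (p : ℤ × ℤ) : Prop :=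
  2 * c + 1 ≤ p.1 ∧ 2 * c + 1 ≤ p.2 ∧ p.1 ≤ (2 * c + 1) * K ∧ p.2 ≤ (2 * c + 1) * K ∧
    p.1 + p.2 ≤ (2 * c + 1) * (2 * K - 1)

/-- The point `t` steps from the branch point `(2 * c + 1) • q` in direction `d`. -/
def ray (c : ℤ) (q d : ℤ × ℤ) (t : ℤ) : ℤ × ℤ :=
  ((2 * c + 1) * q.1 + t * d.1, (2 * c + 1) * q.2 + t * d.2)

/-- The branch point with index `q`. -/
def branch (c : ℤ) (q : ℤ × ℤ) : ℤ × ℤ := ((2 * c + 1) * q.1, (2 * c + 1) * q.2)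

open Classical in
/-- The region to which the sets labelled `i` are confined: the open star of the branch point `i`,
and the complement of the core for the corner `i = (K, K)`. -/
noncomputable def Region (c K : ℤ) (i p : ℤ × ℤ) : Prop :=
  if i = (K, K) then ¬ Core c K p else HexNear (2 * c) p (branch c i)

section Lattice

variable {c K : ℤ} {p p' q q' d d' i j : ℤ × ℤ} {t : ℤ}

theorem le_of_mul_sub_mul_lt {s a b : ℤ} (hs : 0 < s) (h : s * a - s * b < s) : a ≤ b := by
  by_contra! hab
  nlinarith

theorem le_add_one_of_mul_sub_mul_lt {s a b : ℤ} (hs : 0 < s) (h : s * a - s * b < 2 * s) :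
    a ≤ b + 1 := by
  by_contra! hab
  nlinarith

theorem HexNear.symm {n : ℤ} (h : HexNear n p q) : HexNear n q p := by
  unfold HexNear at *; omega

theorem HexNear.refl {n : ℤ} (hn : 0 ≤ n) (p : ℤ × ℤ) : HexNear n p p := by
  unfold HexNear; omega

theorem HexNear.trans {m n : ℤ} {r : ℤ × ℤ} (h : HexNear m p q) (h' : HexNear n q r) :
    HexNear (m + n) p r := by
  unfold HexNear at *; omega

theorem HexNear.mono {m n : ℤ} (h : HexNear m p q) (hmn : m ≤ n) : HexNear n p q := by
  unfold HexNear at *; omega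

theorem InnerIndex.cell_eq (h : InnerIndex K q) : cell K q = q := if_pos h

theorem cell_eq_of_not_inner (h : ¬ InnerIndex K q) : cell K q = (K, K) := if_neg h

theorem InnerIndex.ne (h : InnerIndex K q) : q ≠ (K, K) := by
  rintro rfl
  unfold InnerIndex at h
  omega

theorem region_of_inner (h : InnerIndex K i) : Region c K i p ↔ HexNear (2 * c) p (branch c i) := by
  rw [Region, if_neg h.ne]

theorem region_corner : Region c K (K, K) p ↔ ¬ Core c K p := by
  rw [Region, if_pos rfl]

theorem hexNear_ray (hd : IsDir d) (ht : 0 ≤ t) : HexNear t (ray c q d t) (branch c q) := by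
  rcases hd with rfl | rfl | rfl <;> simp [HexNear, ray, branch] <;> omega

theorem hexNear_ray_end (hd : IsDir d) (ht : t ≤ 2 * c + 1) :
    HexNear (2 * c + 1 - t) (ray c q d t) (branch c (q + d)) := by
  rcases hd with rfl | rfl | rfl <;> simp [HexNear, ray, branch, mul_add] <;> omega

/-- The open star of the branch point `q` lies in the region of the vertex that `q` stands for. -/
theorem region_cell_of_hexNear (hc : 0 ≤ c) (h : HexNear (2 * c) p (branch c q)) :
    Region c K (cell K q) p := by
  by_cases hq : InnerIndex K q
  · rw [hq.cell_eq, region_of_inner hq]; exact h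
  · rw [cell_eq_of_not_inner hq, region_corner]
    rintro ⟨h1, h2, h3, h4, h5⟩
    apply hq
    simp only [HexNear, branch] at h
    have hs : 0 < 2 * c + 1 := by omega
    exact ⟨le_of_mul_sub_mul_lt hs (by omega), le_of_mul_sub_mul_lt hs (by omega),
      le_of_mul_sub_mul_lt hs (by omega), le_of_mul_sub_mul_lt hs (by omega),
      le_of_mul_sub_mul_lt hs (by simp only [mul_add]; omega)⟩

theorem eq_or_eq_of_hexNear_ray (hc : 0 ≤ c) (hd : IsDir d) (ht : 0 ≤ t) (ht' : t ≤ 2 * c + 1)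
    (h : HexNear (2 * c) (ray c q d t) (branch c q')) : q' = q ∨ q' = q + d := by
  have hs : 0 < 2 * c + 1 := by omega
  obtain ⟨a, b⟩ := q
  obtain ⟨a', b'⟩ := q'
  rcases hd with rfl | rfl | rfl <;> simp only [HexNear, ray, branch] at h
  · have h1 : b ≤ b' := le_of_mul_sub_mul_lt hs (by omega)
    have h2 : b' ≤ b := le_of_mul_sub_mul_lt hs (by omega)
    have h3 : a ≤ a' := le_of_mul_sub_mul_lt hs (by omega)
    have h4 : a' ≤ a + 1 := le_add_one_of_mul_sub_mul_lt hs (by omega)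
    simp only [Prod.mk_add_mk, Prod.mk.injEq]; omega
  · have h1 : a + b ≤ a' + b' := le_of_mul_sub_mul_lt hs (by simp only [mul_add]; omega)
    have h2 : a' + b' ≤ a + b := le_of_mul_sub_mul_lt hs (by simp only [mul_add]; omega)
    have h3 : b ≤ b' := le_of_mul_sub_mul_lt hs (by omega)
    have h4 : b' ≤ b + 1 := le_add_one_of_mul_sub_mul_lt hs (by omega)
    simp only [Prod.mk_add_mk, Prod.mk.injEq]; omega
  · have h1 : a ≤ a' := le_of_mul_sub_mul_lt hs (by omega)
    have h2 : a' ≤ a := le_of_mul_sub_mul_lt hs (by omega)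
    have h3 : b' ≤ b := le_of_mul_sub_mul_lt hs (by omega)
    have h4 : b ≤ b' + 1 := le_add_one_of_mul_sub_mul_lt hs (by omega)
    simp only [Prod.mk_add_mk, Prod.mk.injEq]; omega

/-- On a lattice edge only the regions of the two ends of the edge are present. -/
theorem eq_cell_of_region_ray (hc : 0 ≤ c) (hd : IsDir d) (ht : 0 ≤ t) (ht' : t ≤ 2 * c + 1)
    (hi : InnerIndex K i ∨ i = (K, K)) (h : Region c K i (ray c q d t)) :
    i = cell K q ∨ i = cell K (q + d) := by
  rcases hi with hi | rfl
  · rw [region_of_inner hi] at h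
    rcases eq_or_eq_of_hexNear_ray hc hd ht ht' h with rfl | rfl
    · exact Or.inl hi.cell_eq.symm
    · exact Or.inr hi.cell_eq.symm
  · rw [region_corner] at h
    by_contra! hcon
    have h1 : InnerIndex K q := by
      by_contra h1; exact hcon.1 (cell_eq_of_not_inner h1).symm
    have h2 : InnerIndex K (q + d) := by
      by_contra h2; exact hcon.2 (cell_eq_of_not_inner h2).symm
    apply h
    obtain ⟨a, b⟩ := q
    have hs : 0 ≤ 2 * c + 1 := by omega
    -- The core is convex and contains both ends of the edge.
    have aux : ∀ {a b : ℤ}, InnerIndex K (a, b) → 2 * c + 1 ≤ (2 * c + 1) * a ∧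
        2 * c + 1 ≤ (2 * c + 1) * b ∧ (2 * c + 1) * a ≤ (2 * c + 1) * K ∧
        (2 * c + 1) * b ≤ (2 * c + 1) * K ∧
        (2 * c + 1) * a + (2 * c + 1) * b ≤ (2 * c + 1) * (2 * K - 1) := by
      rintro a b ⟨h1, h2, h3, h4, h5⟩
      simp only at h1 h2 h3 h4 h5
      refine ⟨by nlinarith, by nlinarith, by nlinarith, by nlinarith, by nlinarith⟩
    have e1 := aux h1
    have e2 := aux h2
    rcases hd with rfl | rfl | rfl <;> simp only [mul_add] at e2 <;>
      refine ⟨?_, ?_, ?_, ?_, ?_⟩ <;> simp only [ray] <;> omega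

/-- A point on no lattice line lies in every region in which it has a neighbour. -/
theorem region_of_hexNear_one (h1 : ¬ 2 * c + 1 ∣ p.1) (h2 : ¬ 2 * c + 1 ∣ p.2)
    (h3 : ¬ 2 * c + 1 ∣ p.1 + p.2) (hp : HexNear 1 p p') (hi : InnerIndex K i ∨ i = (K, K))
    (h : Region c K i p') : Region c K i p := by
  have n1 : ∀ k, p.1 ≠ (2 * c + 1) * k := fun k hk => h1 ⟨k, hk⟩
  have n2 : ∀ k, p.2 ≠ (2 * c + 1) * k := fun k hk => h2 ⟨k, hk⟩
  have n3 : ∀ k, p.1 + p.2 ≠ (2 * c + 1) * k := fun k hk => h3 ⟨k, hk⟩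
  rcases hi with hi | rfl
  · rw [region_of_inner hi] at h ⊢
    have a1 := n1 (i.1 + 1)
    have a2 := n1 (i.1 - 1)
    have b1 := n2 (i.2 + 1)
    have b2 := n2 (i.2 - 1)
    have c1 := n3 (i.1 + i.2 + 1)
    have c2 := n3 (i.1 + i.2 - 1)
    simp only [mul_add, mul_sub, mul_one] at a1 a2 b1 b2 c1 c2
    simp only [HexNear, branch] at *
    omega
  · rw [region_corner] at h ⊢
    have a1 := n1 1
    have a2 := n1 K
    have b1 := n2 1
    have b2 := n2 K
    have c2 := n3 (2 * K - 1)
    simp only [mul_one] at a1 b1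
    simp only [HexNear, Core] at *
    omega

/-- Regions other than that of the corner are disjoint from the frame. -/
theorem not_frame_of_hexNear (hc : 0 ≤ c) (hi : InnerIndex K i) (h : HexNear (2 * c) p (branch c i)) :
    ¬ Frame c K p := by
  obtain ⟨h1, h2, h3, h4, h5⟩ := hi
  have hs : 0 ≤ 2 * c + 1 := by omega
  have e1 := mul_le_mul_of_nonneg_left h1 hs
  have e2 := mul_le_mul_of_nonneg_left h2 hs
  have e3 := mul_le_mul_of_nonneg_left h3 hs
  have e4 := mul_le_mul_of_nonneg_left h4 hs
  have e5 := mul_le_mul_of_nonneg_left h5 hs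
  simp only [HexNear, branch, Frame, mul_add, mul_sub, mul_one] at *
  omega

theorem Frame.not_core (h : Frame c K p) (hp : HexNear c p p') : ¬ Core c K p' := by
  simp only [HexNear, Frame, Core, mul_add, mul_sub, mul_one] at *
  omega

/-- Let `p` and `p'` be neighbours within distance `c` of the point `t` of the lattice edge from `q`
to `q + d`, where `t` is closer to `q + d`. If `p` lies in the open star of `q` and `p'` does not,
then `p'` lies on a leg of `q + d`: near `q + d` the boundary of the open star of `q` consists of
the two rays at `q + d` that make an angle of `120°` with `d`, and the orientation of the lattice
lines directs both of them away from `q + d`. -/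
theorem mem_leg_of_exit (hd : IsDir d) (hp : HexNear c (ray c q d t) p')
    (hp1 : HexNear 1 p p') (ht : c < t) (ht' : t < 2 * c + 1)
    (hin : HexNear (2 * c) p (branch c q)) (hout : ¬ HexNear (2 * c) p' (branch c q)) :
    ∃ d' t', IsDir d' ∧ 0 ≤ t' ∧ t' ≤ c ∧ p' = ray c (q + d) d' t' := by
  obtain ⟨a, b⟩ := q
  obtain ⟨x, y⟩ := p'
  have h1 : IsDir (1, 0) := Or.inl rfl
  have h2 : IsDir (-1, 1) := Or.inr (Or.inl rfl)
  have h3 : IsDir (0, -1) := Or.inr (Or.inr rfl)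
  rcases hd with rfl | rfl | rfl <;>
    simp only [HexNear, branch, ray] at hp hp1 hin hout
  · by_cases hx : x = (2 * c + 1) * a + (2 * c + 1)
    · refine ⟨(0, -1), (2 * c + 1) * b - y, h3, by omega, by omega, ?_⟩
      simp only [ray, Prod.mk_add_mk, mul_add, Prod.mk.injEq]; omega
    · refine ⟨(-1, 1), y - (2 * c + 1) * b, h2, by omega, by omega, ?_⟩
      simp only [ray, Prod.mk_add_mk, mul_add, Prod.mk.injEq]; omega
  · by_cases hx : x = (2 * c + 1) * a - (2 * c + 1)
    · refine ⟨(0, -1), (2 * c + 1) * b + (2 * c + 1) - y, h3, by omega, by omega, ?_⟩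
      simp only [ray, Prod.mk_add_mk, mul_add, Prod.mk.injEq]; omega
    · refine ⟨(1, 0), x - ((2 * c + 1) * a - (2 * c + 1)), h1, by omega, by omega, ?_⟩
      simp only [ray, Prod.mk_add_mk, mul_add, Prod.mk.injEq]; omega
  · by_cases hx : y = (2 * c + 1) * b - (2 * c + 1)
    · refine ⟨(1, 0), x - (2 * c + 1) * a, h1, by omega, by omega, ?_⟩
      simp only [ray, Prod.mk_add_mk, mul_add, Prod.mk.injEq]; omega
    · refine ⟨(-1, 1), (2 * c + 1) * a - x, h2, by omega, by omega, ?_⟩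
      simp only [ray, Prod.mk_add_mk, mul_add, Prod.mk.injEq]; omega

/-- Every point of a lattice line lies on an edge of the lattice. -/
theorem exists_eq_ray (hc : 0 ≤ c)
    (h : 2 * c + 1 ∣ p.1 ∨ 2 * c + 1 ∣ p.2 ∨ 2 * c + 1 ∣ p.1 + p.2) :
    ∃ q d t, IsDir d ∧ 0 ≤ t ∧ t ≤ 2 * c + 1 ∧ p = ray c q d t := by
  have hs : 0 < 2 * c + 1 := by omega
  obtain ⟨x, y⟩ := p
  rcases h with ⟨k, hk⟩ | ⟨k, hk⟩ | ⟨k, hk⟩ <;> simp only at hk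
  · refine ⟨(k, y / (2 * c + 1) + 1), (0, -1), 2 * c + 1 - y % (2 * c + 1),
      Or.inr (Or.inr rfl), ?_, ?_, ?_⟩
    · have := Int.emod_lt_of_pos y hs; omega
    · have := Int.emod_nonneg y hs.ne'; omega
    · have := Int.mul_ediv_add_emod y (2 * c + 1)
      simp only [ray, mul_add, Prod.mk.injEq]; omega
  · refine ⟨(x / (2 * c + 1), k), (1, 0), x % (2 * c + 1), Or.inl rfl,
      Int.emod_nonneg x hs.ne', (Int.emod_lt_of_pos x hs).le, ?_⟩
    have := Int.mul_ediv_add_emod x (2 * c + 1)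
    simp only [ray, Prod.mk.injEq]; omega
  · refine ⟨(k - y / (2 * c + 1), y / (2 * c + 1)), (-1, 1), y % (2 * c + 1), Or.inr (Or.inl rfl),
      Int.emod_nonneg y hs.ne', (Int.emod_lt_of_pos y hs).le, ?_⟩
    have := Int.mul_ediv_add_emod y (2 * c + 1)
    simp only [ray, mul_sub, Prod.mk.injEq]; omega

end Lattice

/-! ### Geometry of the triangulated grid -/

/-- The position of a vertex of `Γ_m`, as a lattice point. -/
def pos {m : ℕ} (v : Fin m × Fin m) : ℤ × ℤ := ((v.1 : ℕ), (v.2 : ℕ))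

theorem pos_injective {m : ℕ} : Function.Injective (pos (m := m)) := by
  rintro ⟨a, b⟩ ⟨a', b'⟩ h
  simp only [pos, Prod.mk.injEq, Nat.cast_inj] at h
  exact Prod.ext (Fin.ext h.1) (Fin.ext h.2)

theorem exists_pos_eq {m : ℕ} {p : ℤ × ℤ} (h1 : 0 ≤ p.1) (h2 : p.1 < m) (h3 : 0 ≤ p.2)
    (h4 : p.2 < m) : ∃ v : Fin m × Fin m, pos v = p := by
  refine ⟨(⟨p.1.toNat, by omega⟩, ⟨p.2.toNat, by omega⟩), ?_⟩
  apply Prod.ext <;> simp only [pos] <;> omega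

/-- The edges of `Γ_m` in coordinates: those of the triangular lattice and those at the corner. -/
theorem triGrid_adj_iff {m : ℕ} {v w : Fin m × Fin m} : (triGrid m).Adj v w ↔ v ≠ w ∧
    ((∃ d, IsDir d ∧ (pos w = pos v + d ∨ pos v = pos w + d)) ∨
    ((((v.1 : ℕ) + 1 = m ∧ (v.2 : ℕ) + 1 = m) ∧
      ((w.1 : ℕ) = 0 ∨ (w.1 : ℕ) + 1 = m ∨ (w.2 : ℕ) = 0 ∨ (w.2 : ℕ) + 1 = m)) ∨
    (((w.1 : ℕ) + 1 = m ∧ (w.2 : ℕ) + 1 = m) ∧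
      ((v.1 : ℕ) = 0 ∨ (v.1 : ℕ) + 1 = m ∨ (v.2 : ℕ) = 0 ∨ (v.2 : ℕ) + 1 = m)))) := by
  have hd : (∃ d, IsDir d ∧ (pos w = pos v + d ∨ pos v = pos w + d)) ↔
      Nat.dist v.1 w.1 + Nat.dist v.2 w.2 = 1 ∨
        ((v.1 : ℕ) = w.1 + 1 ∧ (w.2 : ℕ) = v.2 + 1) ∨
        ((w.1 : ℕ) = v.1 + 1 ∧ (v.2 : ℕ) = w.2 + 1) := by
    simp only [pos, Nat.dist]
    constructor
    · rintro ⟨d, rfl | rfl | rfl, h | h⟩ <;>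
        simp only [Prod.mk_add_mk, Prod.mk.injEq] at h <;> omega
    · intro h
      by_cases h1 : (v.1 : ℕ) = w.1
      · refine ⟨_, Or.inr (Or.inr rfl), ?_⟩
        simp only [Prod.mk_add_mk, Prod.mk.injEq]; omega
      by_cases h2 : (v.2 : ℕ) = w.2
      · refine ⟨_, Or.inl rfl, ?_⟩
        simp only [Prod.mk_add_mk, Prod.mk.injEq]; omega
      · refine ⟨_, Or.inr (Or.inl rfl), ?_⟩
        simp only [Prod.mk_add_mk, Prod.mk.injEq]; omega
  rw [hd, triGrid, SimpleGraph.fromRel_adj, Nat.dist_comm w.1, Nat.dist_comm w.2]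
  have taut : ∀ P Q Q' R R' : Prop, (P ∨ Q ∨ R) ∨ P ∨ Q' ∨ R' ↔ (P ∨ Q ∨ Q') ∨ R ∨ R' := by tauto
  exact and_congr_right fun _ => taut _ _ _ _ _

section Grid

variable {c m K : ℕ} {v w : Fin m × Fin m}

theorem hexNear_one_of_eq_add {p q d : ℤ × ℤ} (hd : IsDir d) (h : q = p + d) : HexNear 1 p q := by
  subst h
  rcases hd with rfl | rfl | rfl <;> simp only [HexNear, Prod.fst_add, Prod.snd_add] <;> omega

/-- Away from the frame the edges of `Γ_m` are lattice edges. -/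
theorem hexNear_one_of_adj (hm : (2 * c + 1) * (K + 1) < m) (h : (triGrid m).Adj v w)
    (hv : ¬ Frame c K (pos v) ∨ ¬ Frame c K (pos w)) : HexNear 1 (pos v) (pos w) := by
  obtain ⟨-, ⟨d, hd, h | h⟩ | h⟩ := triGrid_adj_iff.1 h
  · exact hexNear_one_of_eq_add hd h
  · exact (hexNear_one_of_eq_add hd h).symm
  · have hm' : ((2 * (c : ℤ) + 1) * (K + 1)) < m := by exact_mod_cast hm
    simp only [Frame, pos] at hv
    omega

/-- A straight segment in one of the three directions is connected. -/
theorem connected_segment {a d : ℤ × ℤ} {n : ℤ} (hn : 0 ≤ n) (hd : IsDir d)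
    (hseg : ∀ t, 0 ≤ t → t ≤ n → ∃ v : Fin m × Fin m, pos v = a + t • d) :
    ((triGrid m).induce {v | ∃ t, 0 ≤ t ∧ t ≤ n ∧ pos v = a + t • d}).Connected := by
  rw [connected_induce_iff_forall_cut]
  constructor
  · obtain ⟨v, hv⟩ := hseg 0 le_rfl hn
    exact ⟨v, 0, le_rfl, hn, hv⟩
  rintro A ⟨v, ⟨t, ht, htn, hv⟩, hvA⟩ ⟨w, ⟨r, hr, hrn, hw⟩, hwA⟩
  by_contra! hcon
  have hadj : ∀ x y : Fin m × Fin m, pos y = pos x + d → (triGrid m).Adj x y := by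
    intro x y hxy
    rw [triGrid_adj_iff]
    refine ⟨?_, Or.inl ⟨d, hd, Or.inl hxy⟩⟩
    rintro rfl
    rcases hd with rfl | rfl | rfl <;> simp at hxy
  -- A set that no edge of the segment crosses contains the whole segment or none of it.
  have key : ∀ (B : Set (Fin m × Fin m)), (∀ x y, (∃ t, 0 ≤ t ∧ t ≤ n ∧ pos x = a + t • d) →
      (∃ t, 0 ≤ t ∧ t ≤ n ∧ pos y = a + t • d) → pos y = pos x + d → (x ∈ B ↔ y ∈ B)) →
      ∀ k : ℕ, (k : ℤ) ≤ n → ∀ x y, pos x = a → pos y = a + (k : ℤ) • d → (x ∈ B ↔ y ∈ B) := by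
    intro B hB k
    induction k with
    | zero =>
      intro _ x y hx hy
      rw [pos_injective (hx.trans (by rw [hy]; simp))]
    | succ k ih =>
      intro hk x y hx hy
      push_cast at hk
      obtain ⟨z, hz⟩ := hseg k (by omega) (by omega)
      refine (ih (by omega) x z hx hz).trans (hB z y ⟨k, by omega, by omega, hz⟩
        ⟨(k + 1 : ℕ), by omega, by push_cast; omega, hy⟩ ?_)
      rw [hy, hz]
      push_cast
      rw [add_smul, one_smul, add_assoc]
  have hA := key A (by
    intro x y hx hy hxy
    constructor
    · intro hxA
      by_contra hyA
      exact hcon x hx y hy hxA hyA (hadj x y hxy)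
    · intro hyA
      by_contra hxA
      exact hcon y hy x hx hyA hxA (hadj x y hxy).symm)
  obtain ⟨o, ho⟩ := hseg 0 le_rfl hn
  rw [zero_smul, add_zero] at ho
  apply hwA
  rw [← hA r.toNat (by omega) o w ho (by rw [hw, Int.toNat_of_nonneg hr]),
    hA t.toNat (by omega) o v ho (by rw [hv, Int.toNat_of_nonneg ht])]
  exact hvA

end Grid

section Grid

variable {c m K : ℕ}

theorem ray_eq (c : ℤ) (q d : ℤ × ℤ) (t : ℤ) : ray c q d t = branch c q + t • d := by
  simp [ray, branch, Prod.ext_iff]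

/-- Only the region of the corner meets the frame. -/
theorem eq_corner_of_frame {i p : ℤ × ℤ} (hi : InnerIndex K i ∨ i = ((K : ℤ), (K : ℤ)))
    (hp : Frame c K p) (h : Region c K i p) : i = ((K : ℤ), (K : ℤ)) := by
  refine hi.resolve_left fun hi => ?_
  rw [region_of_inner hi] at h
  exact not_frame_of_hexNear (by omega) hi h hp

/-- Both ends of the lattice edge from `q` in direction `d` have indices between `0` and `K + 1`. -/
abbrev EdgeInSquare (K : ℤ) (q d : ℤ × ℤ) : Prop :=
  (0 ≤ q.1 ∧ q.1 ≤ K + 1 ∧ 0 ≤ q.2 ∧ q.2 ≤ K + 1) ∧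
    0 ≤ q.1 + d.1 ∧ q.1 + d.1 ≤ K + 1 ∧ 0 ≤ q.2 + d.2 ∧ q.2 + d.2 ≤ K + 1

/-- The two ends of a lattice edge with a point off the frame lie in the square spanned by the
outermost lattice lines. -/
theorem index_bounds {q d : ℤ × ℤ} {t : ℤ} (hd : IsDir d) (ht : 0 ≤ t) (ht' : t ≤ 2 * c + 1)
    (h : ¬ Frame c K (ray c q d t)) :
    EdgeInSquare K q d := by
  obtain ⟨a, b⟩ := q
  have hs : 0 < 2 * (c : ℤ) + 1 := by omega
  have up : ∀ {x y : ℤ}, (2 * (c : ℤ) + 1) * x - (2 * c + 1) * y < 2 * c + 1 → x ≤ y :=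
    fun h => le_of_mul_sub_mul_lt hs h
  rcases hd with rfl | rfl | rfl <;> simp only [Frame, EdgeInSquare, ray, mul_add] at h ⊢
  · have h1 : 0 ≤ a := up (by omega)
    have h2 : a + 1 ≤ K + 1 := up (by simp only [mul_add]; omega)
    have h3 : 0 ≤ b := up (by omega)
    have h4 : b ≤ K + 1 := up (by simp only [mul_add]; omega)
    omega
  · have h1 : 1 ≤ a := up (by omega)
    have h2 : a ≤ K + 1 := up (by simp only [mul_add]; omega)
    have h3 : 0 ≤ b := up (by omega)
    have h4 : b + 1 ≤ K + 1 := up (by simp only [mul_add]; omega)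
    omega
  · have h1 : 0 ≤ a := up (by omega)
    have h2 : a ≤ K + 1 := up (by simp only [mul_add]; omega)
    have h3 : 1 ≤ b := up (by omega)
    have h4 : b ≤ K + 1 := up (by simp only [mul_add]; omega)
    omega

theorem exists_pos_eq_ray (hm : (2 * c + 1) * (K + 1) < m) {q d : ℤ × ℤ} (hd : IsDir d)
    (hq : EdgeInSquare K q d) (t : ℤ) (ht : 0 ≤ t)
    (ht' : t ≤ 2 * c + 1) : ∃ v : Fin m × Fin m, pos v = branch c q + t • d := by
  have hm' : ((2 * (c : ℤ) + 1) * (K + 1)) < m := by exact_mod_cast hm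
  have hs : 0 ≤ 2 * (c : ℤ) + 1 := by omega
  obtain ⟨⟨h1, h2, h3, h4⟩, h5, h6, h7, h8⟩ := hq
  have e1 := mul_nonneg hs h1
  have e2 := mul_le_mul_of_nonneg_left h2 hs
  have e3 := mul_nonneg hs h3
  have e4 := mul_le_mul_of_nonneg_left h4 hs
  have e5 := mul_nonneg hs h5
  have e6 := mul_le_mul_of_nonneg_left h6 hs
  have e7 := mul_nonneg hs h7
  have e8 := mul_le_mul_of_nonneg_left h8 hs
  rw [← ray_eq]
  apply exists_pos_eq <;> rcases hd with rfl | rfl | rfl <;> simp only [ray, mul_add] at * <;> omega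

/-- The vertices of `Γ_m` on the lattice edge from the branch point `q` in direction `d`. -/
def edgeSet (c m : ℕ) (q d : ℤ × ℤ) : Set (Fin m × Fin m) :=
  {v | ∃ t : ℤ, 0 ≤ t ∧ t ≤ 2 * c + 1 ∧ pos v = branch c q + t • d}

/-- The seed of the vertex `i` of `Γ_K`: the initial halves of the three lattice edges leaving each
branch point that stands for `i`, and the frame if `i` is the corner. -/
def seed (c m K : ℕ) (i : ℤ × ℤ) : Set (Fin m × Fin m) :=
  {v | (∃ q d t, IsDir d ∧ 0 ≤ t ∧ t ≤ (c : ℤ) ∧ cell K q = i ∧ pos v = ray c q d t) ∨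
    (i = ((K : ℤ), (K : ℤ)) ∧ Frame c K (pos v))}

theorem connected_frame (hm : (2 * c + 1) * (K + 1) < m) :
    ((triGrid m).induce {v | Frame c K (pos v)}).Connected := by
  have hm' : ((2 * (c : ℤ) + 1) * (K + 1)) < m := by exact_mod_cast hm
  have hm0 : 0 < m := by omega
  let o : Fin m × Fin m := (⟨m - 1, by omega⟩, ⟨m - 1, by omega⟩)
  have ho : Frame c K (pos o) := by
    simp only [Frame, pos, o]; omega
  rw [SimpleGraph.connected_iff_exists_forall_reachable]
  refine ⟨⟨o, ho⟩, ?_⟩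
  -- Moving to the right keeps a vertex in the frame until the boundary of the grid is reached.
  have key : ∀ (n : ℕ) (v : Fin m × Fin m) (hv : Frame c K (pos v)), m - v.1 = n →
      ((triGrid m).induce {v | Frame c K (pos v)}).Reachable ⟨o, ho⟩ ⟨v, hv⟩ := by
    intro n
    induction n with
    | zero => intro v hv h; omega
    | succ n ih =>
      intro v hv h
      by_cases hvo : v = o
      · subst hvo; exact SimpleGraph.Reachable.refl _
      by_cases hb : (v.1 : ℕ) = 0 ∨ (v.1 : ℕ) + 1 = m ∨ (v.2 : ℕ) = 0 ∨ (v.2 : ℕ) + 1 = m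
      · apply SimpleGraph.Adj.reachable
        simp only [SimpleGraph.comap_adj, Function.Embedding.subtype_apply]
        rw [triGrid_adj_iff]
        exact ⟨Ne.symm hvo, Or.inr (Or.inl ⟨⟨Nat.sub_add_cancel hm0, Nat.sub_add_cancel hm0⟩, hb⟩)⟩
      · have hlt : (v.1 : ℕ) + 1 < m := by omega
        have hw : Frame c K (pos ((⟨v.1 + 1, hlt⟩, v.2) : Fin m × Fin m)) := by
          simp only [Frame, pos] at hv ⊢
          push_cast
          omega
        refine (ih _ hw (by simp only; omega)).trans (SimpleGraph.Adj.reachable ?_)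
        simp only [SimpleGraph.comap_adj, Function.Embedding.subtype_apply]
        rw [triGrid_adj_iff]
        refine ⟨?_, Or.inl ⟨(1, 0), Or.inl rfl, Or.inr ?_⟩⟩
        · intro he
          have := congrArg (fun z : Fin m × Fin m => (z.1 : ℕ)) he
          simp at this
        · simp [pos]
  exact fun ⟨v, hv⟩ => key _ v hv rfl

theorem frame_branch_of_not_innerIndex {q : ℤ × ℤ} (h : ¬ InnerIndex K q) :
    Frame c K (branch c q) := by
  by_contra hf
  apply h
  have hs : 0 < 2 * (c : ℤ) + 1 := by omega
  simp only [Frame, branch, mul_add] at hf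
  have up : ∀ {x y : ℤ}, (2 * (c : ℤ) + 1) * x - (2 * c + 1) * y < 0 → x + 1 ≤ y := by
    intro x y h
    by_contra! hxy
    nlinarith
  have h1 : 0 + 1 ≤ q.1 := up (by omega)
  have h2 : 0 + 1 ≤ q.2 := up (by omega)
  have h3 : q.1 + 1 ≤ K + 1 := up (by simp only [mul_add]; omega)
  have h4 : q.2 + 1 ≤ K + 1 := up (by simp only [mul_add]; omega)
  have h5 : q.1 + q.2 + 1 ≤ 2 * K := up (by simp only [mul_add]; omega)
  exact ⟨by omega, by omega, by omega, by omega, by omega⟩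

theorem connected_edgeSet (hm : (2 * c + 1) * (K + 1) < m) {q d : ℤ × ℤ} (hd : IsDir d)
    (hq : EdgeInSquare K q d) :
    ((triGrid m).induce (edgeSet c m q d)).Connected :=
  connected_segment (by omega) hd fun t ht ht' => exists_pos_eq_ray hm hd hq t ht ht'

theorem connected_seed (hm : (2 * c + 1) * (K + 1) < m) {i : ℤ × ℤ}
    (hi : InnerIndex K i ∨ i = ((K : ℤ), (K : ℤ))) :
    ((triGrid m).induce (seed c m K i)).Connected := by
  rcases hi with hi | rfl
  · have hb : ∀ d, IsDir d → ∀ t, 0 ≤ t → t ≤ (c : ℤ) →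
        ∃ v : Fin m × Fin m, pos v = branch c i + t • d := by
      intro d hd t ht htc
      refine exists_pos_eq_ray hm hd ?_ t ht (by omega)
      obtain ⟨h1, h2, h3, h4, h5⟩ := hi
      rcases hd with rfl | rfl | rfl <;> simp only [EdgeInSquare] <;> omega
    obtain ⟨o, ho⟩ := hb (1, 0) (Or.inl rfl) 0 le_rfl (by omega)
    rw [zero_smul, add_zero] at ho
    have hseg : ∀ d, IsDir d → {v : Fin m × Fin m | ∃ t : ℤ, 0 ≤ t ∧ t ≤ c ∧
        pos v = branch c i + t • d} ⊆ seed c m K i := by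
      rintro d hd v ⟨t, ht, htc, hv⟩
      exact Or.inl ⟨i, d, t, hd, ht, htc, hi.cell_eq, by rw [hv, ray_eq]⟩
    refine SimpleGraph.induce_connected_of_patches o
      (hseg (1, 0) (Or.inl rfl) ⟨0, le_rfl, by omega, by simpa using ho⟩) ?_
    rintro v (⟨q, d, t, hd, ht, htc, hq, hv⟩ | ⟨rfl, -⟩)
    · have hqi : q = i := by
        by_cases hq' : InnerIndex K q
        · rw [← hq, hq'.cell_eq]
        · rw [cell_eq_of_not_inner hq'] at hq
          exact absurd hq.symm hi.ne
      subst hqi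
      exact ⟨_, hseg d hd, ⟨0, le_rfl, by omega, by simpa using ho⟩,
        ⟨t, ht, htc, by rw [hv, ray_eq]⟩,
        (connected_segment (by omega) hd (hb d hd)).preconnected _ _⟩
    · exact absurd rfl hi.ne
  · have hF := connected_frame hm
    obtain ⟨⟨o, ho⟩⟩ := hF.nonempty
    have hFs : {v : Fin m × Fin m | Frame c K (pos v)} ⊆ seed c m K ((K : ℤ), (K : ℤ)) :=
      fun v hv => Or.inr ⟨rfl, hv⟩
    refine SimpleGraph.induce_connected_of_patches o (hFs ho) ?_
    rintro v hv
    by_cases hvF : Frame c K (pos v)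
    · exact ⟨_, hFs, ho, hvF, hF.preconnected _ _⟩
    obtain ⟨q, d, t, hd, ht, htc, hq, hv⟩ := hv.resolve_right (fun h => hvF h.2)
    have hq' : ¬ InnerIndex K q := fun h => h.ne (by rw [← hq, h.cell_eq])
    have hb := index_bounds hd ht (by omega) (hv ▸ hvF)
    have hS := connected_segment (m := m) ht hd fun t' ht' htt' =>
      exists_pos_eq_ray hm hd hb t' ht' (by omega)
    obtain ⟨w, hw⟩ := exists_pos_eq_ray hm hd hb 0 le_rfl (by omega)
    have hU := SimpleGraph.induce_union_connected hF.preconnected hS.preconnected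
      ⟨w, by
        rw [Set.mem_ofPred_eq, hw, zero_smul, add_zero]
        exact frame_branch_of_not_innerIndex hq', 0, le_rfl, ht, hw⟩
    refine ⟨_, Set.union_subset hFs ?_, Or.inl ho, Or.inr ?_, hU.preconnected _ _⟩
    swap
    · exact ⟨t, ht, le_rfl, by rw [hv, ray_eq]⟩
    rintro x ⟨t', ht', htt', hx⟩
    exact Or.inl ⟨q, d, t', hd, ht', by omega, hq, by rw [hx, ray_eq]⟩

end Grid

/-! ### Fibres of small diameter in a graph that contracts to a large grid -/

section Confinement

variable {V W : Type*} {J : SimpleGraph V} {H : SimpleGraph W} {σ : V → W} {c m K : ℕ}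
  {φ : V → Fin m × Fin m}

theorem hexNear_one_of_graph_adj (hm : (2 * c + 1) * (K + 1) < m)
    (hφ : ∀ u v, J.Adj u v → φ u = φ v ∨ (triGrid m).Adj (φ u) (φ v)) {u v : V} (huv : J.Adj u v)
    (hF : ¬ Frame c K (pos (φ u)) ∨ ¬ Frame c K (pos (φ v))) :
    HexNear 1 (pos (φ u)) (pos (φ v)) := by
  rcases hφ u v huv with h | h
  · rw [h]; exact HexNear.refl (by omega) _
  · exact hexNear_one_of_adj hm h hF

/-- Distances in `Γ_m` exceed those in the lattice only because of shortcuts through the frame, so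
a point of a fibre is near any other one or near some point of the fibre in the frame. -/
theorem frame_or_hexNear_of_fiber (hm : (2 * c + 1) * (K + 1) < m) (hσ : IsContractionMap c σ H J)
    (hφ : ∀ u v, J.Adj u v → φ u = φ v ∨ (triGrid m).Adj (φ u) (φ v)) {u v : V} (huv : σ u = σ v) :
    (∃ z, σ z = σ v ∧ Frame c K (pos (φ z)) ∧ HexNear c (pos (φ z)) (pos (φ v))) ∨
      HexNear c (pos (φ u)) (pos (φ v)) := by
  have key : ∀ {a b : σ ⁻¹' {σ v}} (w : (J.induce (σ ⁻¹' {σ v})).Walk b a),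
      (∃ z, σ z = σ v ∧ Frame c K (pos (φ z)) ∧ HexNear w.length (pos (φ z)) (pos (φ b))) ∨
        HexNear w.length (pos (φ a)) (pos (φ b)) := by
    intro a b w
    induction w with
    | nil => exact Or.inr (HexNear.refl (by omega) _)
    | @cons b b' a hbb' w ih =>
      by_cases hb : Frame c K (pos (φ b))
      · exact Or.inl ⟨b, b.2, hb, HexNear.refl (by omega) _⟩
      · have h1 := hexNear_one_of_graph_adj hm hφ hbb'.symm (Or.inr hb)
        rw [SimpleGraph.Walk.length_cons]
        push_cast
        rcases ih with ⟨z, hz, hzF, hz'⟩ | h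
        · exact Or.inl ⟨z, hz, hzF, hz'.trans h1⟩
        · exact Or.inr (h.trans h1)
  have hle := (SimpleGraph.edist_le_ediam (G := J.induce (σ ⁻¹' {σ v})) (u := ⟨v, rfl⟩)
    (v := ⟨u, huv⟩)).trans (hσ.ediam_le (σ v))
  obtain ⟨w, hw⟩ := SimpleGraph.exists_walk_of_edist_ne_top
    (ne_top_of_le_ne_top (ENat.natCast_ne_top c) hle)
  have hwc : w.length ≤ c := by rw [← hw] at hle; exact_mod_cast hle
  rcases key w with ⟨z, hz, hzF, hz'⟩ | h
  · exact Or.inl ⟨z, hz, hzF, hz'.mono (by exact_mod_cast hwc)⟩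
  · exact Or.inr (h.mono (by exact_mod_cast hwc))

/-- The fibre of a vertex met by the seed of `i` is confined to the region of `i`. -/
theorem region_of_mem_seed (hm : (2 * c + 1) * (K + 1) < m) (hσ : IsContractionMap c σ H J)
    (hφ : ∀ u v, J.Adj u v → φ u = φ v ∨ (triGrid m).Adj (φ u) (φ v)) {i : ℤ × ℤ} {u v : V}
    (huv : σ u = σ v) (hu : φ u ∈ seed c m K i) : Region c K i (pos (φ v)) := by
  have hframe : ∀ z v, σ z = σ v → Frame c K (pos (φ z)) →
      ∃ z, Frame c K (pos (φ z)) ∧ HexNear c (pos (φ z)) (pos (φ v)) := by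
    intro z v hzv hz
    rcases frame_or_hexNear_of_fiber hm hσ hφ hzv with ⟨z', -, h, h'⟩ | h
    · exact ⟨z', h, h'⟩
    · exact ⟨z, hz, h⟩
  rcases hu with ⟨q, d, t, hd, ht, htc, rfl, hu⟩ | ⟨rfl, hu⟩
  · have hub : HexNear c (pos (φ u)) (branch c q) := by
      rw [hu]; exact (hexNear_ray hd ht).mono htc
    rcases frame_or_hexNear_of_fiber hm hσ hφ huv with ⟨z, hz, hzF, hzv⟩ | h
    · by_cases hq : InnerIndex K q
      · obtain ⟨z', hz'F, hz'u⟩ := hframe z u (hz.trans huv.symm) hzF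
        exact absurd hz'F (not_frame_of_hexNear (by omega) hq
          ((hz'u.trans hub).mono (by omega)))
      · rw [cell_eq_of_not_inner hq, region_corner]
        exact hzF.not_core hzv
    · exact region_cell_of_hexNear (by omega) ((h.symm.trans hub).mono (by omega))
  · rw [region_corner]
    obtain ⟨z, hz, hzv⟩ := hframe u v huv hu
    exact hz.not_core hzv

theorem eq_of_mem_seed (hm : (2 * c + 1) * (K + 1) < m) (hσ : IsContractionMap c σ H J)
    (hφ : ∀ u v, J.Adj u v → φ u = φ v ∨ (triGrid m).Adj (φ u) (φ v)) {i j : ℤ × ℤ}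
    (hi : InnerIndex K i ∨ i = ((K : ℤ), (K : ℤ))) (hj : InnerIndex K j ∨ j = ((K : ℤ), (K : ℤ)))
    {u v : V} (huv : σ u = σ v) (hu : φ u ∈ seed c m K i) (hv : φ v ∈ seed c m K j) : i = j := by
  by_cases hF : ∃ z, σ z = σ v ∧ Frame c K (pos (φ z))
  · obtain ⟨z, hz, hzF⟩ := hF
    rw [eq_corner_of_frame hi hzF (region_of_mem_seed hm hσ hφ (huv.trans hz.symm) hu),
      eq_corner_of_frame hj hzF (region_of_mem_seed hm hσ hφ hz.symm hv)]
  · push Not at hF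
    have hnear : HexNear c (pos (φ u)) (pos (φ v)) :=
      (frame_or_hexNear_of_fiber hm hσ hφ huv).resolve_left fun ⟨z, hz, hzF, _⟩ => hF z hz hzF
    obtain ⟨q, d, t, hd, ht, htc, rfl, hu'⟩ := hu.resolve_right fun h => hF u huv h.2
    obtain ⟨q', d', t', hd', ht', htc', rfl, hv'⟩ := hv.resolve_right fun h => hF v rfl h.2
    rw [hu', hv'] at hnear
    have h1 := eq_or_eq_of_hexNear_ray (q' := q') (by omega) hd ht (by omega)
      ((hnear.trans ((hexNear_ray hd' ht').mono htc')).mono (by omega))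
    have h2 := eq_or_eq_of_hexNear_ray (q' := q) (by omega) hd' ht' (by omega)
      ((hnear.symm.trans ((hexNear_ray hd ht).mono htc)).mono (by omega))
    rcases h1 with rfl | h1
    · rfl
    rcases h2 with rfl | h2
    · rfl
    -- No two of the three directions are opposite.
    exfalso
    rw [h1, Prod.ext_iff] at h2
    simp only [Prod.fst_add, Prod.snd_add] at h2
    rcases hd with rfl | rfl | rfl <;> rcases hd' with rfl | rfl | rfl <;> simp only at h2 <;> omega

/-- A fibre that meets a lattice edge but no seed is confined to the open stars of both ends of the
edge: it is too small to be far from the end that it is close to, and in order to leave the star of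
the other end it would have to cross a seed. -/
theorem hexNear_branch_of_fiber (hm : (2 * c + 1) * (K + 1) < m) (hσ : IsContractionMap c σ H J)
    (hφ : ∀ u v, J.Adj u v → φ u = φ v ∨ (triGrid m).Adj (φ u) (φ v)) {x : W}
    (hF : ∀ v, σ v = x → ¬ Frame c K (pos (φ v)))
    (hleg : ∀ v, σ v = x → ∀ q d t, IsDir d → 0 ≤ t → t ≤ (c : ℤ) → pos (φ v) ≠ ray c q d t)
    {q d : ℤ × ℤ} {t : ℤ} (hd : IsDir d) (ht : 0 ≤ t) (ht' : t ≤ 2 * c + 1) {u v : V}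
    (hu : σ u = x) (hut : pos (φ u) = ray c q d t) (hv : σ v = x) :
    HexNear (2 * c) (pos (φ v)) (branch c q) ∧ HexNear (2 * c) (pos (φ v)) (branch c (q + d)) := by
  have hnear : ∀ v, σ v = x → HexNear c (ray c q d t) (pos (φ v)) := by
    intro v hv
    rw [← hut]
    exact (frame_or_hexNear_of_fiber hm hσ hφ (hu.trans hv.symm)).resolve_left
      fun ⟨z, hz, hzF, _⟩ => hF z (hz.trans hv) hzF
  have htc : (c : ℤ) < t := by
    by_contra! h
    exact hleg u hu q d t hd ht h hut
  have hts : t < 2 * c + 1 := by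
    by_contra! h
    obtain rfl : t = 2 * c + 1 := le_antisymm ht' h
    refine hleg u hu (q + d) d 0 hd le_rfl (by omega) ?_
    rw [hut]
    simp only [ray, Prod.fst_add, Prod.snd_add]
    congr 1 <;> ring
  constructor
  · by_contra hout
    obtain ⟨a, ha, b, hb, haR, hbR, hab⟩ := connected_induce_cut (hσ.connected x)
      {v | HexNear (2 * c) (pos (φ v)) (branch c q)} hu
      (by rw [Set.mem_ofPred_eq, hut]; exact (hexNear_ray hd ht).mono (by omega)) hv hout
    obtain ⟨d', t', hd', h1, h2, h3⟩ := mem_leg_of_exit hd (hnear b hb)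
      (hexNear_one_of_graph_adj hm hφ hab (Or.inl (hF a ha))) htc hts haR hbR
    exact hleg b hb _ _ _ hd' h1 h2 h3
  · exact ((hnear v hv).symm.trans (hexNear_ray_end hd ht')).mono (by omega)

end Confinement

/-! ### The grid as a contraction -/

section Main

variable {V W : Type*} {J : SimpleGraph V} {H : SimpleGraph W} {σ : V → W} {c m K : ℕ}
  {φ : V → Fin m × Fin m}

/-- The index of a vertex of `Γ_K`, counted from `(1, 1)`. -/
def gridIndex (ℓ : Fin K × Fin K) : ℤ × ℤ := ((ℓ.1 : ℕ) + 1, (ℓ.2 : ℕ) + 1)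

theorem gridIndex_injective : Function.Injective (gridIndex (K := K)) := by
  rintro ⟨a, b⟩ ⟨a', b'⟩ h
  simp only [gridIndex, Prod.mk.injEq, add_left_inj, Nat.cast_inj] at h
  exact Prod.ext (Fin.ext h.1) (Fin.ext h.2)

theorem gridIndex_inner_or (ℓ : Fin K × Fin K) :
    InnerIndex K (gridIndex ℓ) ∨ gridIndex ℓ = ((K : ℤ), (K : ℤ)) := by
  obtain ⟨⟨a, ha⟩, ⟨b, hb⟩⟩ := ℓ
  simp only [InnerIndex, gridIndex, Prod.mk.injEq]
  omega

theorem cell_gridIndex (ℓ : Fin K × Fin K) : cell K (gridIndex ℓ) = gridIndex ℓ := by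
  rcases gridIndex_inner_or ℓ with h | h
  · exact h.cell_eq
  · rw [h]; exact cell_eq_of_not_inner fun h => h.ne rfl

theorem exists_gridIndex_eq_cell (hK : 1 ≤ K) (q : ℤ × ℤ) :
    ∃ ℓ : Fin K × Fin K, gridIndex ℓ = cell K q := by
  by_cases hq : InnerIndex K q
  · rw [hq.cell_eq]
    obtain ⟨h1, h2, h3, h4, -⟩ := hq
    refine ⟨(⟨(q.1 - 1).toNat, by omega⟩, ⟨(q.2 - 1).toNat, by omega⟩), ?_⟩
    apply Prod.ext <;> simp only [gridIndex] <;> omega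
  · rw [cell_eq_of_not_inner hq]
    refine ⟨(⟨K - 1, by omega⟩, ⟨K - 1, by omega⟩), ?_⟩
    apply Prod.ext <;> simp only [gridIndex] <;> omega

/-- Regions of distinct nonadjacent vertices of `Γ_K` are at distance at least two. -/
theorem triGrid_adj_of_region {ℓ ℓ' : Fin K × Fin K} (hne : ℓ ≠ ℓ') {p p' : ℤ × ℤ}
    (hp : Region c K (gridIndex ℓ) p) (hp' : Region c K (gridIndex ℓ') p')
    (hpp' : HexNear 1 p p') : (triGrid K).Adj ℓ ℓ' := by
  have hs : 0 < 2 * (c : ℤ) + 1 := by omega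
  -- The case of an inner vertex and the corner: the inner vertex lies on the boundary of `Γ_K`.
  have hout : ∀ {ℓ ℓ' : Fin K × Fin K} {p p' : ℤ × ℤ}, ℓ ≠ ℓ' → Region c K (gridIndex ℓ) p →
      ¬ Core c K p' → HexNear 1 p p' → InnerIndex K (gridIndex ℓ) →
      gridIndex ℓ' = ((K : ℤ), (K : ℤ)) → (triGrid K).Adj ℓ ℓ' := by
    intro ℓ ℓ' p p' hne hp hp' hpp' hi hi'
    rw [triGrid_adj_iff]
    refine ⟨hne, Or.inr (Or.inr ⟨?_, ?_⟩)⟩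
    · simp only [gridIndex, Prod.mk.injEq] at hi'; omega
    · rw [region_of_inner hi] at hp
      by_contra! hb
      apply hp'
      obtain ⟨⟨a, ha⟩, ⟨b, hb'⟩⟩ := ℓ
      simp only at hb
      simp only [HexNear, branch, gridIndex] at hp hpp'
      have e1 := mul_le_mul_of_nonneg_left (show (2 : ℤ) ≤ (a : ℤ) + 1 by omega) hs.le
      have e2 := mul_le_mul_of_nonneg_left (show (2 : ℤ) ≤ (b : ℤ) + 1 by omega) hs.le
      have e3 := mul_le_mul_of_nonneg_left (show (a : ℤ) + 1 ≤ (K : ℤ) - 1 by omega) hs.le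
      have e4 := mul_le_mul_of_nonneg_left (show (b : ℤ) + 1 ≤ (K : ℤ) - 1 by omega) hs.le
      have e5 : (2 * (c : ℤ) + 1) * (2 * K) = 2 * ((2 * c + 1) * K) := by ring
      simp only [Core, mul_sub, mul_one] at *
      omega
  rcases gridIndex_inner_or ℓ with hi | hi <;> rcases gridIndex_inner_or ℓ' with hi' | hi'
  · rw [region_of_inner hi] at hp
    rw [region_of_inner hi'] at hp'
    have hq := (hp.symm.trans hpp').trans hp'
    obtain ⟨⟨a, ha⟩, ⟨b, hb⟩⟩ := ℓ
    obtain ⟨⟨a', ha'⟩, ⟨b', hb'⟩⟩ := ℓ'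
    simp only [HexNear, branch, gridIndex] at hq
    have h1 : (a : ℤ) + 1 ≤ a' + 1 + 1 := le_add_one_of_mul_sub_mul_lt hs (by omega)
    have h2 : (a' : ℤ) + 1 ≤ a + 1 + 1 := le_add_one_of_mul_sub_mul_lt hs (by omega)
    have h3 : (b : ℤ) + 1 ≤ b' + 1 + 1 := le_add_one_of_mul_sub_mul_lt hs (by omega)
    have h4 : (b' : ℤ) + 1 ≤ b + 1 + 1 := le_add_one_of_mul_sub_mul_lt hs (by omega)
    have h5 : ((a : ℤ) + 1) + (b + 1) ≤ (a' + 1) + (b' + 1) + 1 :=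
      le_add_one_of_mul_sub_mul_lt hs (by simp only [mul_add] at *; omega)
    have h6 : ((a' : ℤ) + 1) + (b' + 1) ≤ (a + 1) + (b + 1) + 1 :=
      le_add_one_of_mul_sub_mul_lt hs (by simp only [mul_add] at *; omega)
    rw [triGrid_adj_iff]
    refine ⟨hne, Or.inl ?_⟩
    simp only [ne_eq, Prod.mk.injEq, Fin.mk.injEq] at hne
    by_cases hab : a = a'
    · refine ⟨_, Or.inr (Or.inr rfl), ?_⟩
      simp only [pos, Prod.mk_add_mk, Prod.mk.injEq]; omega
    by_cases hbb : b = b'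
    · refine ⟨_, Or.inl rfl, ?_⟩
      simp only [pos, Prod.mk_add_mk, Prod.mk.injEq]; omega
    · refine ⟨_, Or.inr (Or.inl rfl), ?_⟩
      simp only [pos, Prod.mk_add_mk, Prod.mk.injEq]; omega
  · rw [hi', region_corner] at hp'
    exact hout hne hp hp' hpp' hi hi'
  · rw [hi, region_corner] at hp
    exact (hout hne.symm hp' hp hpp'.symm hi' hi).symm
  · exact absurd (gridIndex_injective (hi.trans hi'.symm)) hne

/-- Every edge of `Γ_K` is realized by a lattice edge. -/
theorem exists_edge_of_triGrid_adj {ℓ ℓ' : Fin K × Fin K} (h : (triGrid K).Adj ℓ ℓ') :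
    ∃ q d : ℤ × ℤ, IsDir d ∧ EdgeInSquare K q d ∧
      ((cell K q = gridIndex ℓ ∧ cell K (q + d) = gridIndex ℓ') ∨
        (cell K q = gridIndex ℓ' ∧ cell K (q + d) = gridIndex ℓ)) := by
  -- A boundary vertex is joined to the corner by an edge leading out of the grid.
  have hout : ∀ ℓ ℓ' : Fin K × Fin K, ((ℓ.1 : ℕ) + 1 = K ∧ (ℓ.2 : ℕ) + 1 = K) →
      ((ℓ'.1 : ℕ) = 0 ∨ (ℓ'.1 : ℕ) + 1 = K ∨ (ℓ'.2 : ℕ) = 0 ∨ (ℓ'.2 : ℕ) + 1 = K) →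
      ∃ q d : ℤ × ℤ, IsDir d ∧ EdgeInSquare K q d ∧
      ((cell K q = gridIndex ℓ ∧ cell K (q + d) = gridIndex ℓ') ∨
        (cell K q = gridIndex ℓ' ∧ cell K (q + d) = gridIndex ℓ)) := by
    intro ℓ ℓ' hc hb
    have hℓ : gridIndex ℓ = ((K : ℤ), (K : ℤ)) := by
      simp only [gridIndex, Prod.mk.injEq]; omega
    have hℓ' := cell_gridIndex ℓ'
    have hx := ℓ'.1.2
    have hy := ℓ'.2.2
    rcases hb with hb | hb | hb | hb
    · refine ⟨(0, (ℓ'.2 : ℕ) + 1), (1, 0), Or.inl rfl, by simp only [EdgeInSquare]; omega,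
        Or.inl ⟨?_, ?_⟩⟩
      · rw [hℓ]; exact cell_eq_of_not_inner fun h => by simp only [InnerIndex] at h; omega
      · rw [← hℓ']; congr 1; simp only [gridIndex, Prod.mk_add_mk, Prod.mk.injEq]; omega
    · refine ⟨gridIndex ℓ', (1, 0), Or.inl rfl,
        by simp only [EdgeInSquare, gridIndex]; omega, Or.inr ⟨hℓ', ?_⟩⟩
      rw [hℓ]
      exact cell_eq_of_not_inner fun h => by
        simp only [InnerIndex, gridIndex, Prod.mk_add_mk] at h; omega
    · refine ⟨gridIndex ℓ', (0, -1), Or.inr (Or.inr rfl),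
        by simp only [EdgeInSquare, gridIndex]; omega, Or.inr ⟨hℓ', ?_⟩⟩
      rw [hℓ]
      exact cell_eq_of_not_inner fun h => by
        simp only [InnerIndex, gridIndex, Prod.mk_add_mk] at h; omega
    · refine ⟨((ℓ'.1 : ℕ) + 1, K + 1), (0, -1), Or.inr (Or.inr rfl),
        by simp only [EdgeInSquare]; omega, Or.inl ⟨?_, ?_⟩⟩
      · rw [hℓ]; exact cell_eq_of_not_inner fun h => by simp only [InnerIndex] at h; omega
      · rw [← hℓ']; congr 1; simp only [gridIndex, Prod.mk_add_mk, Prod.mk.injEq]; omega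
  have hdir : ∀ ℓ ℓ' : Fin K × Fin K, ∀ d, pos ℓ' = pos ℓ + d → gridIndex ℓ' = gridIndex ℓ + d := by
    intro ℓ ℓ' d h
    simp only [pos, gridIndex, Prod.ext_iff, Prod.fst_add, Prod.snd_add] at h ⊢
    omega
  have hbd : ∀ ℓ : Fin K × Fin K, 0 ≤ (gridIndex ℓ).1 ∧ (gridIndex ℓ).1 ≤ K + 1 ∧
      0 ≤ (gridIndex ℓ).2 ∧ (gridIndex ℓ).2 ≤ K + 1 := by
    rintro ⟨⟨a, ha⟩, ⟨b, hb⟩⟩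
    simp only [gridIndex]
    omega
  obtain ⟨-, ⟨d, hd, h | h⟩ | h | h⟩ := triGrid_adj_iff.1 h
  · have hb := hbd ℓ'
    have he := hdir _ _ d h
    rw [he, Prod.fst_add, Prod.snd_add] at hb
    refine ⟨gridIndex ℓ, d, hd, ⟨hbd ℓ, hb⟩, Or.inl ⟨cell_gridIndex ℓ, ?_⟩⟩
    rw [← he, cell_gridIndex]
  · have hb := hbd ℓ
    have he := hdir _ _ d h
    rw [he, Prod.fst_add, Prod.snd_add] at hb
    refine ⟨gridIndex ℓ', d, hd, ⟨hbd ℓ', hb⟩, Or.inr ⟨cell_gridIndex ℓ', ?_⟩⟩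
    rw [← he, cell_gridIndex]
  · exact hout _ _ h.1 h.2
  · obtain ⟨q, d, hd, hb, h⟩ := hout _ _ h.1 h.2
    exact ⟨q, d, hd, hb, h.symm⟩

/-- If `Γ_m` is a contraction of `J` (only the stated consequences for the map `φ` are needed), then
every `c`-diameter contraction of `J` contracts to `Γ_K`, where `m` exceeds
`(2 * c + 1) * (K + 1)`. -/
theorem isContraction_triGrid_of_isContractionMap [Finite W] (hK : 1 ≤ K)
    (hm : (2 * c + 1) * (K + 1) < m) (hσ : IsContractionMap c σ H J)
    (hφ : ∀ u v, J.Adj u v → φ u = φ v ∨ (triGrid m).Adj (φ u) (φ v))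
    (hφc : ∀ Z, ((triGrid m).induce Z).Connected → (J.induce (φ ⁻¹' Z)).Connected) :
    IsContraction (triGrid K) H := by
  -- The vertices of `H` whose fibres meet a given set of vertices of the large grid.
  set T : Set (Fin m × Fin m) → Set W := fun Z => σ '' (φ ⁻¹' Z) with hT
  have hTc : ∀ Z, ((triGrid m).induce Z).Connected → (H.induce (T Z)).Connected :=
    fun Z hZ => hσ.connected_image (hφc Z hZ)
  have hTne : ∀ Z, ((triGrid m).induce Z).Connected → (T Z).Nonempty :=
    fun Z hZ => (connected_induce_iff_forall_cut.1 (hTc Z hZ)).1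
  have : Nonempty (Fin K × Fin K) := ⟨(⟨0, hK⟩, ⟨0, hK⟩)⟩
  -- The end of a lattice edge belongs to the seed of the vertex it stands for.
  have hend : ∀ {q d : ℤ × ℤ}, IsDir d →
      EdgeInSquare K q d →
      (∃ x ∈ T (edgeSet c m q d), x ∈ T (seed c m K (cell K q))) ∧
      ∃ x ∈ T (edgeSet c m q d), x ∈ T (seed c m K (cell K (q + d))) := by
    intro q d hd hq
    have hsingle : ∀ v : Fin m × Fin m, (T {v}).Nonempty := by
      intro v
      refine hTne _ (connected_induce_iff_forall_cut.2 ⟨⟨v, rfl⟩, ?_⟩)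
      rintro A ⟨a, rfl, ha⟩ ⟨b, rfl, hb⟩
      exact absurd ha hb
    constructor
    · obtain ⟨v, hv⟩ := exists_pos_eq_ray hm hd hq 0 le_rfl (by omega)
      obtain ⟨_, u, rfl, rfl⟩ := hsingle v
      exact ⟨_, ⟨u, ⟨0, le_rfl, by omega, hv⟩, rfl⟩, u,
        Or.inl ⟨q, d, 0, hd, le_rfl, by omega, rfl, by rw [hv, ray_eq]⟩, rfl⟩
    · obtain ⟨v, hv⟩ := exists_pos_eq_ray hm hd hq (2 * c + 1) (by omega) le_rfl
      obtain ⟨_, u, rfl, rfl⟩ := hsingle v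
      refine ⟨_, ⟨u, ⟨2 * c + 1, by omega, le_rfl, hv⟩, rfl⟩, u,
        Or.inl ⟨q + d, d, 0, hd, le_rfl, by omega, rfl, ?_⟩, rfl⟩
      rw [hv, ray_eq, branch, branch]
      simp [Prod.ext_iff, mul_add]
  obtain ⟨τ, hτs, hτa, hτc⟩ := exists_connected_labelling H
    (fun x (ℓ : Fin K × Fin K) => ∀ v, σ v = x → Region c K (gridIndex ℓ) (pos (φ v)))
    (fun ℓ => T (seed c m K (gridIndex ℓ)))
    (fun ℓ => hTc _ (connected_seed hm (gridIndex_inner_or ℓ)))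
    (by
      rintro ℓ _ ⟨u, hu, rfl⟩ v hv
      exact region_of_mem_seed hm hσ hφ hv.symm hu)
    (by
      rintro ℓ ℓ' _ ⟨u, hu, rfl⟩ ⟨v, hv, huv⟩
      exact gridIndex_injective (eq_of_mem_seed hm hσ hφ (gridIndex_inner_or ℓ)
        (gridIndex_inner_or ℓ') huv.symm hu hv))
    (by
      intro N hN hNs
      have hcell : ∀ q, ∀ x ∈ T (seed c m K (cell K q)), x ∉ N := by
        intro q x hx
        obtain ⟨ℓ, hℓ⟩ := exists_gridIndex_eq_cell hK q
        exact hNs ℓ x (by rw [hℓ]; exact hx)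
      have hleg : ∀ v, σ v ∈ N → ∀ q d t, IsDir d → 0 ≤ t → t ≤ (c : ℤ) →
          pos (φ v) ≠ ray c q d t :=
        fun v hv q d t hd ht htc h =>
          hcell q _ ⟨v, Or.inl ⟨q, d, t, hd, ht, htc, rfl, h⟩, rfl⟩ hv
      have hcorner : cell K ((K : ℤ), (K : ℤ)) = ((K : ℤ), (K : ℤ)) :=
        cell_eq_of_not_inner fun h => h.ne rfl
      have hF : ∀ v, σ v ∈ N → ¬ Frame c K (pos (φ v)) :=
        fun v hv h => hcell ((K : ℤ), (K : ℤ)) _ ⟨v, Or.inr ⟨hcorner, h⟩, rfl⟩ hv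
      by_cases hline : ∃ v, σ v ∈ N ∧ (2 * (c : ℤ) + 1 ∣ (pos (φ v)).1 ∨
          2 * (c : ℤ) + 1 ∣ (pos (φ v)).2 ∨ 2 * (c : ℤ) + 1 ∣ (pos (φ v)).1 + (pos (φ v)).2)
      · -- A fibre of `N` meets a lattice edge: follow the edge to a fibre outside `N`.
        obtain ⟨v, hvN, hv⟩ := hline
        obtain ⟨q, d, t, hd, ht, ht', hvt⟩ := exists_eq_ray (by omega) hv
        have hq := index_bounds hd ht ht' (hvt ▸ hF v hvN)
        obtain ⟨x₀, hx₀, hx₀s⟩ := (hend hd hq).1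
        obtain ⟨x, ⟨u, ⟨r, hr, hr', hur⟩, rfl⟩, _, ⟨w, ⟨r', h0r', hr'', hwr⟩, rfl⟩, hxN, hyN, hxy⟩ :=
          connected_induce_cut (hTc _ (connected_edgeSet hm hd hq)) N
            ⟨v, ⟨t, ht, ht', by rw [hvt, ray_eq]⟩, rfl⟩ hvN hx₀ (hcell q _ hx₀s)
        rw [← ray_eq] at hur hwr
        refine ⟨_, hxN, _, hyN, hxy.symm, ?_⟩
        intro ℓ hℓ z hz
        have hR := hℓ w rfl
        rw [hwr] at hR
        have hz' := hexNear_branch_of_fiber hm hσ hφ (x := σ u)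
          (fun v hv => hF v (by rw [hv]; exact hxN)) (fun v hv => hleg v (by rw [hv]; exact hxN))
          hd hr hr' rfl hur hz
        rcases eq_cell_of_region_ray (by omega) hd h0r' hr'' (gridIndex_inner_or ℓ) hR with h | h
        · rw [h]; exact region_cell_of_hexNear (by omega) hz'.1
        · rw [h]; exact region_cell_of_hexNear (by omega) hz'.2
      · -- No fibre of `N` meets a lattice line: each of them is confined to a triangle.
        push Not at hline
        obtain ⟨_, hx⟩ := hN
        -- The frame for `K = 0` is the whole grid.
        have huniv : ∀ v : Fin m × Fin m, Frame c (0 : ℕ) (pos v) := by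
          intro v
          simp only [Frame, pos]
          omega
        obtain ⟨y₀, hy₀⟩ := hTne _ (connected_seed hm (Or.inr rfl))
        have hall : ∀ x, x ∈ T {v | Frame c (0 : ℕ) (pos v)} := by
          intro x
          obtain ⟨v, hv⟩ := hσ.surjective x
          exact ⟨v, huniv _, hv⟩
        obtain ⟨x, -, y, -, hxN, hyN, hxy⟩ := connected_induce_cut
          (hTc _ (connected_frame (K := 0) (by nlinarith))) N (hall _) hx (hall y₀)
          (hcell ((K : ℤ), (K : ℤ)) y₀ (by rw [hcorner]; exact hy₀))
        obtain ⟨u, w, rfl, rfl, huw⟩ := hσ.exists_adj hxy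
        refine ⟨_, hxN, _, hyN, hxy.symm, ?_⟩
        intro ℓ hℓ z hz
        have hstep : ∀ a b, σ a = σ u → J.Adj a b → Region c K (gridIndex ℓ) (pos (φ b)) →
            Region c K (gridIndex ℓ) (pos (φ a)) := by
          intro a b ha hab hb
          have haN : σ a ∈ N := by rw [ha]; exact hxN
          obtain ⟨h1, h2, h3⟩ := hline a haN
          exact region_of_hexNear_one h1 h2 h3
            (hexNear_one_of_graph_adj hm hφ hab (Or.inl (hF a haN))) (gridIndex_inner_or ℓ) hb
        by_contra hzR
        obtain ⟨a, -, b, hb, haR, hbR, hab⟩ := connected_induce_cut (hσ.connected (σ u))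
          {v | Region c K (gridIndex ℓ) (pos (φ v))} rfl (hstep u w rfl huw (hℓ w rfl)) hz hzR
        exact hbR (hstep b a hb hab.symm haR))
  refine isContraction_of_connected_fibers τ ?_ hτc ?_
  · intro ℓ
    obtain ⟨x, hx⟩ := hTne _ (connected_seed hm (gridIndex_inner_or ℓ))
    exact ⟨x, hτs ℓ x hx⟩
  intro ℓ ℓ' hne
  constructor
  · intro h
    obtain ⟨q, d, hd, hq, hqℓ⟩ := exists_edge_of_triGrid_adj h
    have hends : (∃ x ∈ T (edgeSet c m q d), τ x = ℓ) ∧ ∃ x ∈ T (edgeSet c m q d), τ x = ℓ' := by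
      obtain ⟨⟨x, hx, hxs⟩, y, hy, hys⟩ := hend hd hq
      rcases hqℓ with ⟨h1, h2⟩ | ⟨h1, h2⟩ <;> rw [h1] at hxs <;> rw [h2] at hys
      · exact ⟨⟨x, hx, hτs _ x hxs⟩, y, hy, hτs _ y hys⟩
      · exact ⟨⟨y, hy, hτs _ y hys⟩, x, hx, hτs _ x hxs⟩
    have honly : ∀ x ∈ T (edgeSet c m q d), τ x = ℓ ∨ τ x = ℓ' := by
      rintro _ ⟨v, ⟨t, ht, ht', hvt⟩, rfl⟩
      have hR := hτa (σ v) v rfl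
      rw [hvt, ← ray_eq] at hR
      have := eq_cell_of_region_ray (by omega) hd ht ht' (gridIndex_inner_or _) hR
      rcases hqℓ with ⟨h1, h2⟩ | ⟨h1, h2⟩ <;> rw [h1, h2] at this
      · exact this.imp (fun h => gridIndex_injective h) fun h => gridIndex_injective h
      · exact this.symm.imp (fun h => gridIndex_injective h) fun h => gridIndex_injective h
    obtain ⟨⟨x, hx, hxℓ⟩, y, hy, hyℓ⟩ := hends
    obtain ⟨u, -, v, hv, huℓ, hvℓ, huv⟩ := connected_induce_cut
      (hTc _ (connected_edgeSet hm hd hq)) (τ ⁻¹' {ℓ}) hx hxℓ hy (fun h => hne (by rw [← hyℓ, h]))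
    exact ⟨u, v, huℓ, (honly v hv).resolve_left hvℓ, huv⟩
  · rintro ⟨x, y, rfl, rfl, hxy⟩
    obtain ⟨u, v, rfl, rfl, huv⟩ := hσ.exists_adj hxy
    have h1 := hτa (σ u) u rfl
    have h2 := hτa (σ v) v rfl
    by_cases hF : Frame c K (pos (φ u)) ∧ Frame c K (pos (φ v))
    · exact absurd (gridIndex_injective
        ((eq_corner_of_frame (gridIndex_inner_or _) hF.1 h1).trans
          (eq_corner_of_frame (gridIndex_inner_or _) hF.2 h2).symm)) hne
    · exact triGrid_adj_of_region hne h1 h2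
        (hexNear_one_of_graph_adj hm hφ huv (not_and_or.1 hF))

end Main

/-! ### Treewidth of contractions -/

section Treewidth

variable {V W : Type*} {c n : ℕ} {σ : V → W} {H : SimpleGraph W} {G : SimpleGraph V}

/-- A contraction inherits the tree-decomposition whose bags are the images of the bags. -/
def TreeDecomposition.image (D : TreeDecomposition G n) (h : IsContractionMap c σ H G) :
    TreeDecomposition H n where
  tree := D.tree
  isTree := D.isTree
  bag t := σ '' D.bag t
  cover := by
    rw [← Set.image_iUnion, D.cover, Set.image_univ, h.surjective.range_eq]
  edge_mem x y hxy := by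
    obtain ⟨u, v, rfl, rfl, huv⟩ := h.exists_adj hxy
    obtain ⟨t, hu, hv⟩ := D.edge_mem u v huv
    exact ⟨t, ⟨u, hu, rfl⟩, v, hv, rfl⟩
  connected x := by
    rw [connected_induce_iff_forall_cut]
    have hne : ∀ v, ∃ t, v ∈ D.bag t := fun v => by
      obtain ⟨t, ht⟩ := (connected_induce_iff_forall_cut.1 (D.connected v)).1
      exact ⟨t, ht⟩
    obtain ⟨v₀, hv₀⟩ := h.surjective x
    obtain ⟨t₀, ht₀⟩ := hne v₀
    refine ⟨⟨t₀, v₀, ht₀, hv₀⟩, ?_⟩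
    rintro A ⟨a, ⟨u, hua, hu⟩, haA⟩ ⟨b, ⟨v, hvb, hv⟩, hbA⟩
    by_contra! hcon
    -- The subtree of each vertex of the fibre of `x` lies on one side of the cut, and subtrees of
    -- adjacent vertices meet.
    have hside : ∀ w, σ w = x → ∀ t t', w ∈ D.bag t → w ∈ D.bag t' → t ∈ A → t' ∈ A := by
      intro w hw t t' ht ht' htA
      by_contra ht'A
      obtain ⟨r, hr, r', hr', hrA, hrA', hrr'⟩ := connected_induce_cut (D.connected w) A ht htA
        ht' ht'A
      exact hcon r ⟨w, hr, hw⟩ r' ⟨w, hr', hw⟩ hrA hrA' hrr'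
    obtain ⟨y, hy, z, hz, ⟨t, hyt, htA⟩, hzA, hyz⟩ := connected_induce_cut (h.connected x)
      {w | ∃ t, w ∈ D.bag t ∧ t ∈ A} hu ⟨a, hua, haA⟩ hv
      (by rintro ⟨t, hvt, htA⟩; exact hbA (hside v hv t b hvt hvb htA))
    obtain ⟨r, hyr, hzr⟩ := D.edge_mem y z hyz
    exact hzA ⟨r, hzr, hside y hy t r hyt hyr htA⟩

/-- A tree-decomposition of a contraction lifts to one whose bags are the preimages of the bags. -/
def TreeDecomposition.preimage (D : TreeDecomposition H n) (h : IsContractionMap c σ H G) :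
    TreeDecomposition G n where
  tree := D.tree
  isTree := D.isTree
  bag t := σ ⁻¹' D.bag t
  cover := by
    rw [← Set.preimage_iUnion, D.cover, Set.preimage_univ]
  edge_mem u v huv := by
    by_cases hne : σ u = σ v
    · obtain ⟨t, ht⟩ := (connected_induce_iff_forall_cut.1 (D.connected (σ u))).1
      exact ⟨t, ht, by rw [Set.mem_preimage, ← hne]; exact ht⟩
    · exact D.edge_mem _ _ (h.adj_of_adj huv hne)
  connected v := D.connected (σ v)

/-- The decomposition with a single bag. -/
def TreeDecomposition.trivial (G : SimpleGraph V) : TreeDecomposition G 1 where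
  tree := ⊥
  isTree := SimpleGraph.IsTree.of_subsingleton
  bag _ := Set.univ
  cover := Set.iUnion_const _
  edge_mem _ _ _ := ⟨0, Set.mem_univ _, Set.mem_univ _⟩
  connected v := by
    rw [connected_induce_iff_forall_cut]
    refine ⟨⟨0, Set.mem_univ v⟩, ?_⟩
    rintro A ⟨a, -, ha⟩ ⟨b, -, hb⟩
    rw [Subsingleton.elim a b] at ha
    exact absurd ha hb

theorem TreeDecomposition.width_add_one_le (D : TreeDecomposition G n) {k : ℕ} (hk : 1 ≤ k)
    (h : ∀ t, (D.bag t).ncard ≤ k) : D.width + 1 ≤ k := by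
  have : (Finset.univ.sup fun t => (D.bag t).ncard) ≤ k := Finset.sup_le fun t _ => h t
  rw [TreeDecomposition.width]
  omega

theorem TreeDecomposition.ncard_bag_le (D : TreeDecomposition G n) (t : Fin n) :
    (D.bag t).ncard ≤ D.width + 1 := by
  have : (D.bag t).ncard ≤ Finset.univ.sup fun t => (D.bag t).ncard :=
    Finset.le_sup (f := fun t => (D.bag t).ncard) (Finset.mem_univ t)
  rw [TreeDecomposition.width]
  omega

theorem ncard_preimage_le [Finite V] [Finite W] {s : ℕ} (hσ : ∀ x, (σ ⁻¹' {x}).ncard ≤ s)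
    (B : Set W) : (σ ⁻¹' B).ncard ≤ s * B.ncard := by
  classical
  have := Fintype.ofFinite V
  have := Fintype.ofFinite W
  rw [Set.ncard_eq_toFinset_card', Set.ncard_eq_toFinset_card']
  refine Finset.card_le_mul_card_image_of_maps_to (f := σ) (fun v hv => by simpa using hv) s ?_
  intro x _
  refine le_trans ?_ (hσ x)
  rw [Set.ncard_eq_toFinset_card']
  refine Finset.card_le_card fun v hv => ?_
  simpa using (Finset.mem_filter.1 hv).2

end Treewidth

namespace MultiGraph

theorem exists_width_eq_treewidth (G : MultiGraph.{u}) :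
    ∃ (n : ℕ) (D : TreeDecomposition G.simple n), D.width = G.treewidth :=
  Nat.sInf_mem (s := {w | ∃ (n : ℕ) (D : TreeDecomposition G.simple n), D.width = w})
    ⟨_, 1, TreeDecomposition.trivial _, rfl⟩

theorem treewidth_le {G : MultiGraph.{u}} {n : ℕ} (D : TreeDecomposition G.simple n) :
    G.treewidth ≤ D.width :=
  Nat.sInf_le ⟨n, D, rfl⟩

theorem treewidth_add_one_le_of_diamContraction {H J : MultiGraph.{u}} {c : ℕ}
    (h : IsDiamContraction c H.simple J.simple) : H.treewidth + 1 ≤ J.treewidth + 1 := by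
  obtain ⟨σ, hσ⟩ := h
  have := J.finite
  obtain ⟨n, D, hD⟩ := J.exists_width_eq_treewidth
  refine (Nat.add_le_add_right (treewidth_le (D.image hσ)) 1).trans ?_
  refine TreeDecomposition.width_add_one_le _ (by omega) fun t => ?_
  rw [← hD]
  exact (Set.ncard_image_le (Set.toFinite _)).trans (D.ncard_bag_le t)

theorem treewidth_add_one_le_of_sizeContraction {G J : MultiGraph.{u}} {s : ℕ} (hs : 0 < s)
    (h : IsSizeContraction s G.simple J.simple) : J.treewidth + 1 ≤ s * (G.treewidth + 1) := by
  obtain ⟨c, σ, hσ, hcard⟩ := h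
  have := J.finite
  have := G.finite
  obtain ⟨n, D, hD⟩ := G.exists_width_eq_treewidth
  refine (Nat.add_le_add_right (treewidth_le (D.preimage hσ)) 1).trans ?_
  refine TreeDecomposition.width_add_one_le _ (by nlinarith) fun t => ?_
  rw [← hD]
  exact (ncard_preimage_le (fun x => (hcard x).2) _).trans
    (Nat.mul_le_mul_left s (D.ncard_bag_le t))

/-! ### Grid contractions and the extension of a class -/

theorem bddAbove_setOf_isContraction_triGrid (G : MultiGraph.{u}) :
    BddAbove {k | IsContraction (triGrid k) G.simple} := by
  have := G.finite
  refine ⟨Nat.card G.V, ?_⟩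
  rintro k ⟨c, σ, hσ⟩
  have := Nat.card_le_card_of_surjective σ hσ.surjective
  rw [Nat.card_prod, Nat.card_fin] at this
  nlinarith

/-- Excluding `Γ_k` as a contraction passes from `H` to `G`, with `k` enlarged by a factor of about
`2 * c₂ + 1`, if `G` is a contraction and `H` is a `c₂`-diameter contraction of the same graph. -/
theorem not_isContraction_triGrid {G H J : MultiGraph.{u}} {s c₂ k m : ℕ} (hk : 1 ≤ k)
    (hm : (2 * c₂ + 1) * (k + 1) < m) (hG : IsSizeContraction s G.simple J.simple)
    (hH : IsDiamContraction c₂ H.simple J.simple) (h : ¬ IsContraction (triGrid k) H.simple) :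
    ¬ IsContraction (triGrid m) G.simple := by
  rintro ⟨c, α, hα⟩
  obtain ⟨c', ψ, hψ, -⟩ := hG
  obtain ⟨σ, hσ⟩ := hH
  have := H.finite
  refine h (isContraction_triGrid_of_isContractionMap (φ := α ∘ ψ) hk hm hσ ?_ ?_)
  · intro u v huv
    by_cases h1 : α (ψ u) = α (ψ v)
    · exact Or.inl h1
    · exact Or.inr (hα.adj_of_adj (hψ.adj_of_adj huv fun h2 => h1 (by rw [h2])) h1)
  · intro Z hZ
    rw [Set.preimage_comp]
    exact hψ.connected_preimage (hα.connected_preimage hZ)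

theorem bcg_le {G H J : MultiGraph.{u}} {s c₂ : ℕ} (hG : IsSizeContraction s G.simple J.simple)
    (hH : IsDiamContraction c₂ H.simple J.simple) :
    G.bcg ≤ (2 * c₂ + 1) * (H.bcg + 2) + 1 := by
  by_contra! hlt
  have hne : {k | IsContraction (triGrid k) G.simple}.Nonempty := by
    by_contra hemp
    rw [Set.not_nonempty_iff_eq_empty] at hemp
    have h0 : G.bcg = 0 := by rw [bcg, hemp]; exact csSup_empty
    omega
  refine not_isContraction_triGrid (k := H.bcg + 1) (by omega)
    (by rw [add_assoc]; exact (Nat.lt_succ_self _).trans hlt) hG hH ?_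
    (Nat.sSup_mem hne G.bddAbove_setOf_isContraction_triGrid)
  intro h
  have := le_csSup H.bddAbove_setOf_isContraction_triGrid h
  change H.bcg + 1 ≤ H.bcg at this
  omega

theorem treewidth_add_one_le {G H J : MultiGraph.{u}} {s c₂ : ℕ} (hs : 0 < s)
    (hG : IsSizeContraction s G.simple J.simple) (hH : IsDiamContraction c₂ H.simple J.simple) :
    (H.treewidth : ℝ) + 1 ≤ s * (G.treewidth + 1) := by
  exact_mod_cast (treewidth_add_one_le_of_diamContraction hH).trans
    (treewidth_add_one_le_of_sizeContraction hs hG)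

end MultiGraph

theorem mainTheorem1 (𝒢 : Set MultiGraph.{u}) (c : ℝ) (hc1 : 1 ≤ c) (hc2 : c < 2)
    (c₁ c₂ : ℕ) (hc₁ : 0 < c₁) (hc₂ : 0 < c₂) :
    (HasSQGC 𝒢 c → HasSQGC (graphExtension 𝒢 c₁ c₂) c) ∧
    ∀ lam : ℝ, 0 ≤ lam →
      (∀ G ∈ 𝒢, (G.treewidth : ℝ) ≤ lam * (G.bcg : ℝ) ^ c) →
      ∀ H ∈ graphExtension 𝒢 c₁ c₂,
        (H.treewidth : ℝ) ≤
          ((c₁ : ℝ) + 1) *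
            (lam * ((2 * (c₂ : ℝ) + 1) * ((H.bcg : ℝ) + 2) + 1) ^ c + 1) - 1 := by
  have hc0 : 0 ≤ c := by linarith
  constructor
  · rintro ⟨C, hC⟩
    refine ⟨c₁ * (|C| * ((4 * c₂ + 4 : ℕ) : ℝ) ^ c + 1), ?_⟩
    rintro H ⟨G, hG, J, hGJ, hHJ⟩ t ht hHt
    -- `(4 * c₂ + 4) * t` exceeds `(2 * c₂ + 1) * (t + 1)`.
    have hGt := hC G hG ((4 * c₂ + 4) * t) (by nlinarith)
      (MultiGraph.not_isContraction_triGrid ht (by nlinarith) hGJ hHJ hHt)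
    have htw := MultiGraph.treewidth_add_one_le hc₁ hGJ hHJ
    have ht1 : (1 : ℝ) ≤ (t : ℝ) ^ c := Real.one_le_rpow (by exact_mod_cast ht) hc0
    rw [Nat.cast_mul, Real.mul_rpow (Nat.cast_nonneg _) (Nat.cast_nonneg _), ← mul_assoc] at hGt
    have hC' : C * ((4 * c₂ + 4 : ℕ) : ℝ) ^ c * (t : ℝ) ^ c ≤
        |C| * ((4 * c₂ + 4 : ℕ) : ℝ) ^ c * (t : ℝ) ^ c := by
      gcongr
      exact le_abs_self C
    calc (H.treewidth : ℝ) ≤ c₁ * (G.treewidth + 1) := by linarith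
      _ ≤ c₁ * (|C| * ((4 * c₂ + 4 : ℕ) : ℝ) ^ c * (t : ℝ) ^ c + (t : ℝ) ^ c) := by
          gcongr
          exact hGt.trans hC'
      _ = _ := by ring
  · intro lam hlam hbcg
    rintro H ⟨G, hG, J, hGJ, hHJ⟩
    have htw := MultiGraph.treewidth_add_one_le hc₁ hGJ hHJ
    have hb : (G.bcg : ℝ) ≤ (2 * (c₂ : ℝ) + 1) * ((H.bcg : ℝ) + 2) + 1 := by
      exact_mod_cast MultiGraph.bcg_le hGJ hHJ
    have hG' : (G.treewidth : ℝ) ≤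
        lam * ((2 * (c₂ : ℝ) + 1) * ((H.bcg : ℝ) + 2) + 1) ^ c :=
      (hbcg G hG).trans (by gcongr)
    have h0 : (0 : ℝ) ≤ lam * ((2 * (c₂ : ℝ) + 1) * ((H.bcg : ℝ) + 2) + 1) ^ c := by positivity
    have h1 : (c₁ : ℝ) * (G.treewidth + 1) ≤
        c₁ * (lam * ((2 * (c₂ : ℝ) + 1) * ((H.bcg : ℝ) + 2) + 1) ^ c + 1) := by gcongr
    linarith
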